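/- Throughout, $\log$ is the binary logarithm. Let $C(x|y)$ be the conditional plain Kolmogorov complexity and $K(x|y)$ the conditional prefix Kolmogorov complexity of binary strings, defined by an arbitrary universal machine and an arbitrary universal prefix machine, respectively; natural numbers are identified with binary strings by $0,1,2,3,4,\ldots\mapsto\epsilon,0,1,00,01,\ldots$. A labeled graph $G$ on the nodes $\{1,\ldots,n\}$ is represented by the binary string $E(G)$ of length $\binom n2$ whose bits tell, for the pairs of nodes in lexicographic order, whether the pair is an edge, and $K(H|n)$ means $K(E(H)|n)$. For a labeled graph $H$ on $\{1,\ldots,k\}$, an ordered labeled occurrence of $H$ in $G$ is a set of $k$ nodes $i_1<\cdots<i_k$ of $G$ such that relabeling $i_1,\ldots,i_k$ as $1,\ldots,k$ turns the induced subgraph into $H$; let $\#H(G)$ be the number of these occurrences (which may overlap). Theorem. There is a constant $c$, depending only on the two reference machines, such that the following holds for every real-valued function $\delta$ on the natural numbers. Let $G$ be a labeled graph on $n$ nodes with $C(E(G)|n)\ge\binom n2-\delta(n)$, let $k$ be a positive integer that divides $n$ and satisfies $k\le\sqrt{2\log n}$, and let $H$ be a labeled graph on $k$ nodes. Put $p=2^{-k(k-1)/2}$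 and $$\alpha=\left(K(H|n)+\delta(n)+\log\left(\binom nk\Big/\frac nk\right)+c\right)\frac{3}{\log e}.$$ Then $$\left|\#H(G)-\binom nk p\right|\le\binom nk\sqrt{\alpha\,\frac kn\,p}.$$ -/

import Mathlib

/-! ### Description methods and Kolmogorov complexity -/

/-- A machine that takes a binary program and a binary condition and, if it halts, outputs a
binary string. -/
abbrev Machine : Type := List Bool → List Bool →. List Bool

/-- `M` is computable by a Turing machine. -/
def Machine.IsComputable (M : Machine) : Prop := Partrec₂ M

/-- For each fixed condition, no halting program is a proper prefix of another one. -/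
def Machine.IsPrefixFree (M : Machine) : Prop :=
  ∀ y p q : List Bool, (M p y).Dom → (M q y).Dom → p <+: q → p = q

/-- `U` simulates `M` at the cost of a constant number of additional program bits. -/
def Machine.Simulates (U M : Machine) : Prop :=
  ∃ c : ℕ, ∀ p y x : List Bool, x ∈ M p y →
    ∃ q : List Bool, q.length ≤ p.length + c ∧ x ∈ U q y

/-- `U` is a universal machine: a computable machine that simulates every computable machine with
a constant overhead in program length. -/
structure Machine.IsUniversal (U : Machine) : Prop where
  computable : U.IsComputable
  simulates : ∀ M : Machine, M.IsComputable → U.Simulates M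

/-- `V` is a universal prefix machine: a computable prefix-free machine that simulates every
computable prefix-free machine with a constant overhead in program length. -/
structure Machine.IsUniversalPrefix (V : Machine) : Prop where
  computable : V.IsComputable
  prefixFree : V.IsPrefixFree
  simulates : ∀ M : Machine, M.IsComputable → M.IsPrefixFree → V.Simulates M

/-- The conditional complexity of `x` given `y` with respect to `M`: the length of a shortest
program that makes `M` output `x` under the condition `y`. It is the plain complexity `C(x|y)` if
`M` is a universal machine, and the prefix complexity `K(x|y)` if `M` is a universal prefix
machine; in both cases such a program exists for all `x` and `y`. -/
noncomputable def Machine.complexity (M : Machine) (x y : List Bool) : ℕ :=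
  sInf {l : ℕ | ∃ p : List Bool, p.length = l ∧ x ∈ M p y}

/-- The identification of natural numbers with binary strings:
`0 ↦ ε, 1 ↦ 0, 2 ↦ 1, 3 ↦ 00, 4 ↦ 01, …`, that is, the binary expansion of `n + 1`, most
significant bit first, without its leading `1`. -/
def natToString (n : ℕ) : List Bool := (Nat.bits (n + 1)).dropLast.reverse

/-! ### Universal machines exist -/

/-- Splits `1^i 0 q` into `i` and `q`. -/
def Machine.parse (p : List Bool) : Option (ℕ × List Bool) :=
  (p[p.findIdx (fun b => !b)]?).map fun _ =>
    (p.findIdx (fun b => !b), p.drop (p.findIdx (fun b => !b) + 1))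

theorem Machine.parse_append (i : ℕ) (q : List Bool) :
    Machine.parse (List.replicate i true ++ false :: q) = some (i, q) := by
  have h : (List.replicate i true ++ false :: q).findIdx (fun b => !b) = i := by
    induction i with
    | zero => simp [List.findIdx_cons]
    | succ i ih => simp [List.replicate_succ, List.findIdx_cons, ih]
  simp [Machine.parse, h, List.drop_append]

theorem Machine.eq_of_parse {p : List Bool} {i : ℕ} {q : List Bool}
    (h : Machine.parse p = some (i, q)) : p = List.replicate i true ++ false :: q := by
  induction p generalizing i q with
  | nil => simp [Machine.parse] at h
  | cons b p ih =>
    cases b with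
    | false =>
      simp [Machine.parse, List.findIdx_cons] at h
      obtain ⟨rfl, rfl⟩ := h
      rfl
    | true =>
      simp only [Machine.parse, List.findIdx_cons, Bool.not_true, cond_false,
        List.getElem?_cons_succ, List.drop_succ_cons, Option.map_eq_some_iff, Prod.mk.injEq] at h
      obtain ⟨b, hb, rfl, rfl⟩ := h
      rw [List.replicate_succ, List.cons_append,
        ← ih (i := p.findIdx fun b => !b) (by simp [Machine.parse, hb])]

theorem Machine.computable_parse : Computable Machine.parse := by
  have h1 : Primrec fun p : List Bool => p.findIdx (fun b => !b) :=
    Primrec.list_findIdx Primrec.id (Primrec.not.comp Primrec.snd).to₂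
  have h2 : Primrec fun p : List Bool => p[p.findIdx (fun b => !b)]? :=
    Primrec.list_getElem?.comp Primrec.id h1
  have h3 : Primrec fun p : List Bool =>
      (p.findIdx (fun b => !b), p.drop (p.findIdx (fun b => !b) + 1)) :=
    h1.pair (Primrec.list_drop.comp (Primrec.succ.comp h1) Primrec.id)
  exact (Primrec.option_map h2 (h3.comp Primrec.fst).to₂).to_comp

/-- The machine that runs member `i` of an enumeration `F` on the program `1^i 0 q`. -/
def Machine.ofFamily (F : Nat.Partrec.Code → Machine) : Machine := fun p y =>
  (Machine.parse p : Part (ℕ × List Bool)).bind fun iq =>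
    F (Denumerable.ofNat Nat.Partrec.Code iq.1) iq.2 y

theorem Machine.computable_ofFamily (F : Nat.Partrec.Code → Machine)
    (hF : Partrec fun a : Nat.Partrec.Code × List Bool × List Bool => F a.1 a.2.1 a.2.2) :
    (Machine.ofFamily F).IsComputable := by
  refine Partrec.bind (Computable.ofOption (Machine.computable_parse.comp Computable.fst)) ?_
  exact hF.comp (((Computable.ofNat _).comp (Computable.fst.comp Computable.snd)).pair
    ((Computable.snd.comp Computable.snd).pair (Computable.snd.comp Computable.fst)))

theorem Machine.ofFamily_append (F : Nat.Partrec.Code → Machine) (c : Nat.Partrec.Code)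
    (q y : List Bool) :
    Machine.ofFamily F (List.replicate (Encodable.encode c) true ++ false :: q) y = F c q y := by
  simp [Machine.ofFamily, Machine.parse_append]

theorem Machine.simulates_ofFamily (F : Nat.Partrec.Code → Machine) (c : Nat.Partrec.Code) :
    (Machine.ofFamily F).Simulates (F c) :=
  ⟨Encodable.encode c + 1, fun p y x hx =>
    ⟨List.replicate (Encodable.encode c) true ++ false :: p, by simp; omega, by
      rwa [Machine.ofFamily_append]⟩⟩

/-- The machine computed by a code. -/
def Machine.ofCode (c : Nat.Partrec.Code) : Machine := fun p y =>
  (c.eval (Encodable.encode (p, y))).bind fun z => (Encodable.decode z : Option (List Bool))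

theorem Machine.exists_code {M : Machine} (hM : M.IsComputable) :
    ∃ c : Nat.Partrec.Code, ∀ m : ℕ, c.eval m =
      ((Encodable.decode m : Option (List Bool × List Bool)) : Part (List Bool × List Bool)).bind fun a =>
        (M a.1 a.2).map Encodable.encode := by
  obtain ⟨c, hc⟩ := Nat.Partrec.Code.exists_code.1 hM
  exact ⟨c, fun m => by rw [hc]⟩

theorem Machine.exists_isUniversal : ∃ U : Machine, U.IsUniversal := by
  refine ⟨Machine.ofFamily Machine.ofCode, Machine.computable_ofFamily _ ?_, fun M hM => ?_⟩
  · refine Partrec.bind (Nat.Partrec.Code.eval_part.comp Computable.fst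
      (Computable.encode.comp Computable.snd)) ?_
    exact Computable.ofOption (Computable.decode.comp Computable.snd)
  · obtain ⟨c, hc⟩ := Machine.exists_code hM
    have : Machine.ofCode c = M := by
      funext p y
      unfold Machine.ofCode
      rw [hc, Encodable.encodek]
      simp [Part.bind_map, Part.bind_some_right]
    exact this ▸ Machine.simulates_ofFamily _ c

/-- `m` codes a pair of a program and the condition `y`, where the program is comparable with and
different from `p`. -/
def Machine.conflict (a : List Bool × List Bool) (m : ℕ) : Bool :=
  ((Encodable.decode m : Option (List Bool × List Bool)).map fun b =>
    decide (b.2 = a.2) && !decide (b.1 = a.1) &&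
      (decide (b.1 = a.1.take b.1.length) || decide (a.1 = b.1.take a.1.length))).getD false

theorem Machine.conflict_encode (p q y : List Bool) :
    Machine.conflict (p, y) (Encodable.encode (q, y)) = true ↔
      q ≠ p ∧ (q <+: p ∨ p <+: q) := by
  simp [Machine.conflict, List.prefix_iff_eq_take]

theorem Machine.primrec_conflict : Primrec₂ Machine.conflict := by
  have hd : ∀ {α : Type} [Primcodable α] {f g : α → List Bool}, Primrec f → Primrec g →
      Primrec fun a => decide (f a = g a) := fun hf hg => (Primrec.eq.comp hf hg).decide
  have ht : Primrec₂ fun (u v : List Bool) => v.take u.length :=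
    Primrec.list_take.comp (Primrec.list_length.comp Primrec.fst) Primrec.snd
  have a1 : Primrec fun t : ((List Bool × List Bool) × ℕ) × (List Bool × List Bool) => t.1.1.1 :=
    Primrec.fst.comp (Primrec.fst.comp Primrec.fst)
  have a2 : Primrec fun t : ((List Bool × List Bool) × ℕ) × (List Bool × List Bool) => t.1.1.2 :=
    Primrec.snd.comp (Primrec.fst.comp Primrec.fst)
  have b1 : Primrec fun t : ((List Bool × List Bool) × ℕ) × (List Bool × List Bool) => t.2.1 :=
    Primrec.fst.comp Primrec.snd
  have b2 : Primrec fun t : ((List Bool × List Bool) × ℕ) × (List Bool × List Bool) => t.2.2 :=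
    Primrec.snd.comp Primrec.snd
  refine Primrec.option_getD.comp (Primrec.option_map (Primrec.decode.comp Primrec.snd) ?_)
    (Primrec.const false)
  exact Primrec.and.comp (Primrec.and.comp (hd b2 a2) (Primrec.not.comp (hd b1 a1)))
    (Primrec.or.comp (hd b1 (ht.comp b1 a1)) (hd a1 (ht.comp a1 b1)))

/-- No program in conflict with `p` under the condition `y` halts within `s` steps. -/
def Machine.NoConflict (c : Nat.Partrec.Code) (p y : List Bool) (s : ℕ) : Prop :=
  ∀ m < s, ¬ ((c.evaln s m).isSome = true ∧ Machine.conflict (p, y) m = true)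

theorem Machine.primrecPred_noConflict :
    PrimrecPred fun t : (Nat.Partrec.Code × List Bool × List Bool) × ℕ =>
      Machine.NoConflict t.1.1 t.1.2.1 t.1.2.2 t.2 := by
  have key : PrimrecRel fun (m : ℕ) (t : (Nat.Partrec.Code × List Bool × List Bool) × ℕ) =>
      ¬ ((Nat.Partrec.Code.evaln t.2 t.1.1 m).isSome = true ∧
        Machine.conflict t.1.2 m = true) := ?_
  · exact (key.forall_mem_list.comp (Primrec.list_range.comp Primrec.snd) Primrec.id).of_eq
      fun t => by simp [Machine.NoConflict]
  have c1 : Primrec fun a : ℕ × ((Nat.Partrec.Code × List Bool × List Bool) × ℕ) =>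
      (Nat.Partrec.Code.evaln a.2.2 a.2.1.1 a.1).isSome :=
    Primrec.option_isSome.comp (Nat.Partrec.Code.primrec_evaln.comp
      (((Primrec.snd.comp Primrec.snd).pair
        (Primrec.fst.comp (Primrec.fst.comp Primrec.snd))).pair Primrec.fst))
  have c2 : Primrec fun a : ℕ × ((Nat.Partrec.Code × List Bool × List Bool) × ℕ) =>
      Machine.conflict a.2.1.2 a.1 :=
    Machine.primrec_conflict.comp (Primrec.snd.comp (Primrec.fst.comp Primrec.snd)) Primrec.fst
  exact ((Primrec.eq.comp c1 (Primrec.const true)).and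
    (Primrec.eq.comp c2 (Primrec.const true))).not

open Classical in
/-- The machine computed by a code, restricted to those programs that halt before every program
in conflict with them. -/
noncomputable def Machine.prefixOfCode (c : Nat.Partrec.Code) : Machine := fun p y =>
  (Nat.rfind fun s => Part.some (c.evaln s (Encodable.encode (p, y))).isSome).bind fun s =>
    ((if Machine.NoConflict c p y s then
      (c.evaln s (Encodable.encode (p, y))).bind Encodable.decode else none :
        Option (List Bool)) : Part (List Bool))

theorem Machine.partrec_prefixOfCode :
    Partrec fun a : Nat.Partrec.Code × List Bool × List Bool =>
      Machine.prefixOfCode a.1 a.2.1 a.2.2 := by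
  have e : Primrec₂ fun (a : Nat.Partrec.Code × List Bool × List Bool) (s : ℕ) =>
      Nat.Partrec.Code.evaln s a.1 (Encodable.encode a.2) :=
    Nat.Partrec.Code.primrec_evaln.comp ((Primrec.snd.pair (Primrec.fst.comp Primrec.fst)).pair
      (Primrec.encode.comp (Primrec.snd.comp Primrec.fst)))
  refine Partrec.bind (Partrec.rfind (Computable.partrec
    (Primrec.option_isSome.comp e).to_comp)) ?_
  refine Computable.ofOption (Primrec.to_comp ?_)
  classical
  refine Primrec.ite Machine.primrecPred_noConflict
    (Primrec.option_bind e ?_) (Primrec.const none)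
  exact Primrec.decode.comp Primrec.snd

theorem Machine.mem_prefixOfCode {c : Nat.Partrec.Code} {p y x : List Bool}
    (h : x ∈ Machine.prefixOfCode c p y) :
    ∃ s, (c.evaln s (Encodable.encode (p, y))).isSome ∧ Machine.NoConflict c p y s ∧
      (c.evaln s (Encodable.encode (p, y))).bind Encodable.decode = some x := by
  obtain ⟨s, h1, h2⟩ := Part.mem_bind_iff.1 h
  have h1 := Part.mem_some_iff.1 (Nat.rfind_spec h1)
  split_ifs at h2 with h3
  · exact ⟨s, h1.symm, h3, by simpa using h2⟩
  · simp at h2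

theorem Machine.prefixFree_prefixOfCode (c : Nat.Partrec.Code) :
    (Machine.prefixOfCode c).IsPrefixFree := by
  intro y p q hp hq hpq
  obtain ⟨s, hs, hs', -⟩ := Machine.mem_prefixOfCode (Part.get_mem hp)
  obtain ⟨t, ht, ht', -⟩ := Machine.mem_prefixOfCode (Part.get_mem hq)
  by_contra hne
  have key : ∀ {p q : List Bool} {s t : ℕ}, s ≤ t → p ≠ q → (p <+: q ∨ q <+: p) →
      (c.evaln s (Encodable.encode (p, y))).isSome →
      ¬ Machine.NoConflict c q y t := by
    intro p q s t hst hne hpq hs hn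
    obtain ⟨z, hz⟩ := Option.isSome_iff_exists.1 hs
    have hz' := Nat.Partrec.Code.evaln_mono hst hz
    refine hn _ (Nat.Partrec.Code.evaln_bound hz') ⟨?_, ?_⟩
    · exact Option.isSome_iff_exists.2 ⟨z, hz'⟩
    · exact (Machine.conflict_encode _ _ _).2 ⟨hne, hpq⟩
  rcases le_total s t with h | h
  · exact key h hne (.inl hpq) hs ht'
  · exact key h (Ne.symm hne) (.inr hpq) ht hs'

theorem Machine.prefixOfCode_eq {M : Machine} (hM : M.IsPrefixFree) {c : Nat.Partrec.Code}
    (hc : ∀ m : ℕ, c.eval m =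
      ((Encodable.decode m : Option (List Bool × List Bool)) : Part (List Bool × List Bool)).bind fun a =>
        (M a.1 a.2).map Encodable.encode)
    {p y x : List Bool} (hx : x ∈ M p y) : x ∈ Machine.prefixOfCode c p y := by
  classical
  have h1 : Encodable.encode x ∈ c.eval (Encodable.encode (p, y)) := by
    rw [hc, Encodable.encodek]
    simpa using Part.mem_map Encodable.encode hx
  obtain ⟨k, hk⟩ := Nat.Partrec.Code.evaln_complete.1 h1
  have hex : ∃ s, (c.evaln s (Encodable.encode (p, y))).isSome :=
    ⟨k, Option.isSome_iff_exists.2 ⟨_, hk⟩⟩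
  refine Part.mem_bind (a := Nat.find hex) ?_ ?_
  · refine Nat.mem_rfind.2 ⟨Part.mem_some_iff.2 (Nat.find_spec hex).symm, fun {m} hm => ?_⟩
    exact Part.mem_some_iff.2 (by simpa using Nat.find_min hex hm)
  · obtain ⟨z, hz⟩ := Option.isSome_iff_exists.1 (Nat.find_spec hex)
    have hzx : z = Encodable.encode x :=
      Part.mem_unique (Nat.Partrec.Code.evaln_sound hz) h1
    rw [if_pos, hz, hzx]
    · simp
    · rintro m - ⟨hm, hcf⟩
      obtain ⟨w, hw⟩ := Option.isSome_iff_exists.1 hm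
      have hcf' := hcf
      unfold Machine.conflict at hcf'
      rcases hd : (Encodable.decode m : Option (List Bool × List Bool)) with _ | ⟨r, y'⟩
      · simp [hd] at hcf'
      · simp only [hd, Option.map_some, Option.getD_some, Bool.and_eq_true, Bool.or_eq_true,
          decide_eq_true_eq, Bool.not_eq_true', decide_eq_false_iff_not] at hcf'
        obtain ⟨⟨rfl, hne⟩, hpre⟩ := hcf'
        have hw' := Nat.Partrec.Code.evaln_sound hw
        rw [hc, hd] at hw'
        have hdom : (M r y').Dom := by
          obtain ⟨a, ha, hw'⟩ := Part.mem_bind_iff.1 hw'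
          obtain rfl : a = (r, y') := by simpa using ha
          exact (Part.mem_map_iff _).1 hw' |>.elim fun b hb => Part.dom_iff_mem.2 ⟨b, hb.1⟩
        have hpdom : (M p y').Dom := Part.dom_iff_mem.2 ⟨x, hx⟩
        rcases hpre with h | h
        · exact hne (hM _ _ _ hdom hpdom (List.prefix_iff_eq_take.2 h))
        · exact hne (hM _ _ _ hpdom hdom (List.prefix_iff_eq_take.2 h)).symm

theorem Machine.exists_isUniversalPrefix : ∃ V : Machine, V.IsUniversalPrefix := by
  refine ⟨Machine.ofFamily Machine.prefixOfCode,
    Machine.computable_ofFamily _ Machine.partrec_prefixOfCode, ?_, fun M hM hM' => ?_⟩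
  · intro y p q hp hq hpq
    obtain ⟨x, hx⟩ := Part.dom_iff_mem.1 hp
    obtain ⟨x', hx'⟩ := Part.dom_iff_mem.1 hq
    obtain ⟨⟨i, u⟩, hi, hxu⟩ := Part.mem_bind_iff.1 hx
    obtain ⟨⟨j, v⟩, hj, hxv⟩ := Part.mem_bind_iff.1 hx'
    obtain rfl := Machine.eq_of_parse (by simpa using hi)
    obtain rfl := Machine.eq_of_parse (by simpa using hj)
    have key : ∀ {i j : ℕ}, List.replicate i true ++ false :: u <+:
        List.replicate j true ++ false :: v → i = j ∧ u <+: v := by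
      intro i
      induction i with
      | zero => rintro (_ | j) h <;> simp_all [List.replicate_succ, List.cons_prefix_cons]
      | succ i ih =>
        rintro (_ | j) h
        · simp_all [List.replicate_succ, List.cons_prefix_cons]
        · simp only [List.replicate_succ, List.cons_append, List.cons_prefix_cons] at h
          exact ⟨congrArg _ (ih h.2).1, (ih h.2).2⟩
    obtain ⟨rfl, huv⟩ := key hpq
    rw [Machine.prefixFree_prefixOfCode _ y u v (Part.dom_iff_mem.2 ⟨x, hxu⟩)
      (Part.dom_iff_mem.2 ⟨x', hxv⟩) huv]
  · obtain ⟨c, hc⟩ := Machine.exists_code hM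
    obtain ⟨k, hk⟩ := Machine.simulates_ofFamily Machine.prefixOfCode c
    exact ⟨k, fun p y x hx => hk p y x (Machine.prefixOfCode_eq hM' hc hx)⟩

/-! ### Labeled graphs -/

open Classical in
/-- The binary string representing a labeled graph on `n` nodes: the bit `1` for an edge and `0`
for a non-edge, over all pairs `i < j` of nodes in lexicographic order. -/
noncomputable def edgeString {n : ℕ} (G : SimpleGraph (Fin n)) : List Bool :=
  (List.finRange n).flatMap fun i =>
    ((List.finRange n).filter fun j => i < j).map fun j => decide (G.Adj i j)

/-- The set `S` of nodes of `G` is an ordered labeled occurrence of `H`: it has `k` elements, and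
relabeling its elements in increasing order turns the subgraph of `G` induced by `S` into `H`. -/
def IsOccurrence {n k : ℕ} (H : SimpleGraph (Fin k)) (G : SimpleGraph (Fin n))
    (S : Finset (Fin n)) : Prop :=
  ∃ h : S.card = k, ∀ a b : Fin k,
    G.Adj (S.orderEmbOfFin h a) (S.orderEmbOfFin h b) ↔ H.Adj a b

open Classical in
/-- The number of ordered labeled occurrences of `H` in `G`. -/
noncomputable def occurrences {n k : ℕ} (H : SimpleGraph (Fin k)) (G : SimpleGraph (Fin n)) : ℕ :=
  (Finset.univ.filter fun S : Finset (Fin n) => IsOccurrence H G S).card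

/-- The probability that a labeled graph on `k` nodes obtained by tossing a fair coin for each pair
of nodes equals a given one. -/
noncomputable def subgraphProb (k : ℕ) : ℝ := ((2 : ℝ) ^ k.choose 2)⁻¹

/-- The quantity `α`, where `C(E(G)|n)` falls short of `n.choose 2` by at most `d`, `K(H|n)` is the
prefix complexity with respect to `V`, and `c` is the additive constant. -/
noncomputable def alpha (V : Machine) (c d : ℝ) (n : ℕ) {k : ℕ} (H : SimpleGraph (Fin k)) : ℝ :=
  (V.complexity (edgeString H) (natToString n) + d
      + Real.logb 2 ((n.choose k : ℝ) / ((n : ℝ) / k)) + c)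
    * 3 / Real.logb 2 (Real.exp 1)

/-! ### Describing a string by its index in a computable list -/

/-! A graph whose number of occurrences of H is far from the mean belongs to a small set that is
easy to list, so it has a short description. Given n and E(H), the strings of all graphs on n nodes
can be sorted by their number of occurrences. Then G is described by a shortest prefix program for
E(H) followed by the index of E(G) in this list or in its reverse. Prefix-freeness separates the two
parts at no cost (`Machine.mem_indexed`), and neither δ nor the deviation has to be encoded. The
index is below the number of graphs that are at least as extreme as G on its side of the mean
(`exists_complexity_le_stringOccurrences`).

Under fair coin tosses the mean is C(n,k)p, and a pair of nodes lies in only C(n-2,k-2) node sets of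
size k. McDiarmid's inequality (`card_le_of_bounded_differences`) therefore bounds the number of
graphs in a tail at deviation d by 2^C(n,2) exp(-2d²/W), where W = C(n,2) C(n-2,k-2)². Taking
logarithms gives C(E(G)|n) ≤ K(H|n) + C(n,2) - (2d²/W) log e + c
(`exists_complexity_le_of_deviation`), and the randomness of G turns this into (2d²/W) log e ≤
K(H|n) + δ(n) + c.

It remains to see that W ≤ 6 C(n,k)² (k/n) p (`choose_two_mul_sq_le`). For large n this holds
because k ≤ √(2 log n) keeps k³ 2^C(k,2) below 6n (`exists_forall_cube_mul_le`). For the finitely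
many other n the additive constant is chosen so large that the claim follows from the trivial bound
C(n,k) on the deviation. For k = 1 there is no deviation. -/

theorem Machine.IsUniversalPrefix.exists_program {V : Machine} (hV : V.IsUniversalPrefix)
    (x y : List Bool) : ∃ p, x ∈ V p y := by
  -- Only the empty program halts, and it prints the fixed string `x`.
  let M : Machine := fun p _ => ((if p = [] then some x else none : Option (List Bool)) : Part _)
  have hM : M.IsComputable := by
    refine Computable.ofOption (Primrec.to_comp ?_)
    exact Primrec.ite (Primrec.eq.comp Primrec.fst (Primrec.const [])) (Primrec.const (some x))
      (Primrec.const none)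
  have hM' : M.IsPrefixFree := by
    intro y p q hp hq _
    have key : ∀ p, (M p y).Dom → p = [] := by
      intro p hp
      by_contra h
      simp [M, h] at hp
    rw [key p hp, key q hq]
  obtain ⟨c, hc⟩ := hV.simulates M hM hM'
  obtain ⟨q, -, hq⟩ := hc [] y x (by simp [M])
  exact ⟨q, hq⟩

/-- The infimum in `complexity` is attained because its set is nonempty; for an empty set it would
be the default value 0. -/
theorem Machine.IsUniversalPrefix.exists_shortest {V : Machine} (hV : V.IsUniversalPrefix)
    (x y : List Bool) : ∃ p, p.length = V.complexity x y ∧ x ∈ V p y := by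
  obtain ⟨p, hp⟩ := hV.exists_program x y
  exact Nat.sInf_mem (s := {l : ℕ | ∃ p : List Bool, p.length = l ∧ x ∈ V p y}) ⟨_, p, rfl, hp⟩

/-- The inverse of `natToString`. -/
def stringToNat (l : List Bool) : ℕ := l.foldl (fun a b => 2 * a + b.toNat) 1 - 1

/-- `bits` starts with the least significant bit, so `dropLast` removes the leading 1; the initial
value 1 of the fold restores it. -/
theorem foldl_dropLast_bits (n : ℕ) (hn : n ≠ 0) :
    (n.bits.dropLast.reverse).foldl (fun a b => 2 * a + b.toNat) 1 = n := by
  induction n using Nat.binaryRec with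
  | zero => exact absurd rfl hn
  | bit b m ih =>
    by_cases hm : m = 0
    · subst hm
      cases b
      · exact absurd rfl hn
      · simp
    · have hb : m.bits ≠ [] := fun h => hm (Nat.size_eq_zero.1 (by rw [← Nat.size_eq_bits_len, h]; rfl))
      rw [Nat.bits_append_bit _ _ fun h => absurd h hm, List.dropLast_cons_of_ne_nil hb,
        List.reverse_cons, List.foldl_append, ih hm, Nat.bit_val]
      rfl

theorem stringToNat_natToString (n : ℕ) : stringToNat (natToString n) = n := by
  rw [stringToNat, natToString, foldl_dropLast_bits _ n.succ_ne_zero, Nat.succ_sub_one]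

theorem two_pow_length_natToString_le (n : ℕ) : 2 ^ (natToString n).length ≤ n + 1 := by
  have h : (natToString n).length = (n + 1).size - 1 := by
    simp [natToString, Nat.size_eq_bits_len]
  have h1 : 0 < (n + 1).size := Nat.size_pos.2 n.succ_pos
  exact Nat.lt_size.1 (by omega)

theorem primrec_stringToNat : Primrec stringToNat := by
  have hb : Primrec Bool.toNat := Primrec.dom_finite _
  have h : Primrec fun l : List Bool => l.foldl (fun a b => 2 * a + b.toNat) 1 := by
    refine Primrec.list_foldl (h := fun _ (a : ℕ × Bool) => 2 * a.1 + a.2.toNat) Primrec.id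
      (Primrec.const 1) ?_
    exact Primrec.nat_add.comp (Primrec.nat_mul.comp (Primrec.const 2)
      (Primrec.fst.comp Primrec.snd)) (hb.comp (Primrec.snd.comp Primrec.snd))
  exact Primrec.nat_sub.comp h (Primrec.const 1)

/-- Searches for a way of splitting the program into a program for the machine computed by `c` and
a binary number, and outputs the entry with this number in a list that depends on the condition
and on the output of `c`. -/
def Machine.indexed (c : Nat.Partrec.Code) (D : List Bool → List Bool → List (List Bool)) :
    Machine := fun p y =>
  (Nat.rfind fun t =>
    Part.some (c.evaln t.unpair.1 (Encodable.encode (p.take t.unpair.2, y))).isSome).bind fun t =>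
    ((((c.evaln t.unpair.1 (Encodable.encode (p.take t.unpair.2, y))).bind
      Encodable.decode).bind fun h : List Bool => (D y h)[stringToNat (p.drop t.unpair.2)]? :
        Option (List Bool)) : Part (List Bool))

theorem Machine.computable_indexed (c : Nat.Partrec.Code)
    {D : List Bool → List Bool → List (List Bool)} (hD : Primrec₂ D) :
    (Machine.indexed c D).IsComputable := by
  have e : Primrec₂ fun (a : List Bool × List Bool) (t : ℕ) =>
      c.evaln t.unpair.1 (Encodable.encode (a.1.take t.unpair.2, a.2)) := by
    refine Nat.Partrec.Code.primrec_evaln.comp (((Primrec.fst.comp (Primrec.unpair.comp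
      Primrec.snd)).pair (Primrec.const c)).pair (Primrec.encode.comp (Primrec.pair ?_ ?_)))
    · exact Primrec.list_take.comp (Primrec.snd.comp (Primrec.unpair.comp Primrec.snd))
        (Primrec.fst.comp Primrec.fst)
    · exact Primrec.snd.comp Primrec.fst
  refine Partrec.bind (Partrec.rfind (Computable.partrec
    (Primrec.option_isSome.comp e).to_comp)) ?_
  refine Computable.ofOption (Primrec.to_comp ?_)
  refine Primrec.option_bind (Primrec.option_bind e (Primrec.decode.comp Primrec.snd)) ?_
  refine Primrec.list_getElem?.comp (hD.comp (Primrec.snd.comp (Primrec.fst.comp Primrec.fst))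
    Primrec.snd) (primrec_stringToNat.comp (Primrec.list_drop.comp ?_ ?_))
  · exact Primrec.snd.comp (Primrec.unpair.comp (Primrec.snd.comp Primrec.fst))
  · exact Primrec.fst.comp (Primrec.fst.comp Primrec.fst)

/-- Every halting initial segment of `p ++ q` is comparable with `p`, hence equal to it by
prefix-freeness. So the search splits the program correctly, whichever successful `t` it meets
first. -/
theorem Machine.mem_indexed {V : Machine} (hV : V.IsPrefixFree) {c : Nat.Partrec.Code}
    (hc : ∀ m : ℕ, c.eval m =
      ((Encodable.decode m : Option (List Bool × List Bool)) : Part (List Bool × List Bool)).bind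
        fun a => (V a.1 a.2).map Encodable.encode)
    {D : List Bool → List Bool → List (List Bool)} {p y h q x : List Bool} (hp : h ∈ V p y)
    (hx : (D y h)[stringToNat q]? = some x) : x ∈ Machine.indexed c D (p ++ q) y := by
  have hev : ∀ r, c.eval (Encodable.encode (r, y)) = (V r y).map Encodable.encode := by
    intro r
    rw [hc, Encodable.encodek]
    simp
  have h1 : Encodable.encode h ∈ c.eval (Encodable.encode (p, y)) := by
    rw [hev]; exact Part.mem_map _ hp
  obtain ⟨s, hs⟩ := Nat.Partrec.Code.evaln_complete.1 h1
  have hex : ∃ t : ℕ,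
      (c.evaln t.unpair.1 (Encodable.encode ((p ++ q).take t.unpair.2, y))).isSome :=
    ⟨Nat.pair s p.length, Option.isSome_iff_exists.2 ⟨_, by simpa using hs⟩⟩
  refine Part.mem_bind (a := Nat.find hex) ?_ ?_
  · refine Nat.mem_rfind.2 ⟨Part.mem_some_iff.2 (Nat.find_spec hex).symm, fun {m} hm => ?_⟩
    exact Part.mem_some_iff.2 (by simpa using Nat.find_min hex hm)
  · obtain ⟨z, hz⟩ := Option.isSome_iff_exists.1 (Nat.find_spec hex)
    set t := Nat.find hex with ht
    have hz' := Nat.Partrec.Code.evaln_sound hz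
    rw [hev] at hz'
    obtain ⟨w, hw, rfl⟩ := (Part.mem_map_iff _).1 hz'
    have hpd : (V p y).Dom := Part.dom_iff_mem.2 ⟨_, hp⟩
    have hwd : (V ((p ++ q).take t.unpair.2) y).Dom := Part.dom_iff_mem.2 ⟨_, hw⟩
    have htake : (p ++ q).take t.unpair.2 = p := by
      rcases List.prefix_or_prefix_of_prefix (List.take_prefix t.unpair.2 (p ++ q))
        (List.prefix_append p q) with h | h
      · exact hV _ _ _ hwd hpd h
      · exact (hV _ _ _ hpd hwd h).symm
    -- For empty `q` the cut may lie beyond the end of `p`, so the rest is identified by cancelling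
    -- `p` and not by comparing lengths.
    have hdrop : (p ++ q).drop t.unpair.2 = q := by
      have := List.take_append_drop t.unpair.2 (p ++ q)
      rw [htake] at this
      exact List.append_cancel_left this
    rw [htake] at hw
    obtain rfl := Part.mem_unique hw hp
    rw [hz, hdrop]
    simpa using hx

/-- A member of a primitive recursive list that depends on `y` and `h` is described by a shortest
prefix program for `h` followed by its index. -/
theorem Machine.exists_complexity_le_of_getElem? {U V : Machine} (hU : U.IsUniversal)
    (hV : V.IsUniversalPrefix) {D : List Bool → List Bool → List (List Bool)} (hD : Primrec₂ D) :
    ∃ c : ℕ, ∀ (y h x : List Bool) (i : ℕ), (D y h)[i]? = some x →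
      U.complexity x y ≤ V.complexity h y + (natToString i).length + c := by
  obtain ⟨e, he⟩ := Machine.exists_code hV.computable
  obtain ⟨c, hc⟩ := hU.simulates _ (Machine.computable_indexed e hD)
  refine ⟨c, fun y h x i hi => ?_⟩
  obtain ⟨p, hp, hpx⟩ := hV.exists_shortest h y
  obtain ⟨r, hr, hrx⟩ := hc (p ++ natToString i) y x
    (Machine.mem_indexed hV.prefixFree he hpx (by rwa [stringToNat_natToString]))
  refine (Nat.sInf_le (s := {l : ℕ | ∃ p : List Bool, p.length = l ∧ x ∈ U p y})
    ⟨r, rfl, hrx⟩).trans (hr.trans ?_)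
  simp [hp]

/-- A member of a list that is sorted by `r` has an index below the number of elements that are
related to it. -/
theorem List.exists_getElem?_lt_card {α : Type*} [DecidableEq α] {r : α → α → Prop} {l : List α}
    (hl : l.Pairwise r) (hn : l.Nodup) {x : α} (hx : x ∈ l) {s : Finset α}
    (hs : ∀ a ∈ l, r a x → a ∈ s) (hxs : x ∈ s) :
    ∃ i < s.card, l[i]? = some x := by
  refine ⟨l.idxOf x, ?_, List.getElem?_idxOf hx⟩
  have hi := List.idxOf_lt_length_of_mem hx
  -- Counting `x` together with its predecessors makes the bound on the index strict.
  have hsub : (l.take (l.idxOf x + 1)).toFinset ⊆ s := by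
    intro a ha
    obtain ⟨j, hj, rfl⟩ := List.getElem_of_mem (List.mem_toFinset.1 ha)
    have hj' : j < l.idxOf x + 1 := by
      rw [List.length_take] at hj; omega
    rw [List.getElem_take]
    rcases Nat.lt_succ_iff_lt_or_eq.1 hj' with h | h
    · refine hs _ (List.getElem_mem _) ?_
      have := List.pairwise_iff_getElem.1 hl j (l.idxOf x) (h.trans hi) hi h
      rwa [List.getElem_idxOf] at this
    · subst h
      simpa using hxs
  have := Finset.card_le_card hsub
  rw [List.toFinset_card_of_nodup (hn.sublist (List.take_sublist _ _)), List.length_take,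
    min_eq_left (by omega)] at this
  omega

/-! ### Listing the strings of graphs by their number of occurrences -/

/-- All bit strings of a given length. -/
def boolLists : ℕ → List (List Bool)
  | 0 => [[]]
  | m + 1 => (boolLists m).flatMap fun l => [false :: l, true :: l]

theorem mem_boolLists {m : ℕ} {l : List Bool} : l ∈ boolLists m ↔ l.length = m := by
  induction m generalizing l with
  | zero => simp [boolLists]
  | succ m ih =>
    rw [boolLists, List.mem_flatMap]
    cases l with
    | nil => simp
    | cons b l => cases b <;> simp [ih]

theorem nodup_boolLists (m : ℕ) : (boolLists m).Nodup := by
  induction m with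
  | zero => simp [boolLists]
  | succ m ih =>
    rw [boolLists, List.nodup_flatMap]
    refine ⟨fun l _ => by simp, ih.imp fun {a b} hab => ?_⟩
    simp [Function.onFun, List.disjoint_left, hab]

theorem primrec_boolLists : Primrec boolLists := by
  have h : Primrec fun n : ℕ => (Nat.rec [[]] (fun _ L => L.flatMap fun l =>
      [false :: l, true :: l]) n : List (List Bool)) := by
    refine Primrec.nat_rec' Primrec.id (Primrec.const _)
      (h := fun _ (a : ℕ × List (List Bool)) => a.2.flatMap fun l => [false :: l, true :: l]) ?_
    refine Primrec.list_flatMap (Primrec.snd.comp Primrec.snd) ?_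
    exact Primrec.list_cons.comp (Primrec.list_cons.comp (Primrec.const _) Primrec.snd)
      (Primrec.list_cons.comp (Primrec.list_cons.comp (Primrec.const _) Primrec.snd)
        (Primrec.const _))
  refine h.of_eq fun n => ?_
  induction n with
  | zero => rfl
  | succ n ih => rw [boolLists, ← ih]

/-- The pairs `i < j < n` in lexicographic order. -/
def natPairs (n : ℕ) : List (ℕ × ℕ) :=
  (List.range n).flatMap fun i => ((List.range n).filter fun j => i < j).map fun j => (i, j)

theorem primrec_natPairs : Primrec natPairs := by
  have hf : Primrec₂ fun (n i : ℕ) => (List.range n).filter fun j => i < j := by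
    have hR : PrimrecRel fun (j i : ℕ) => i < j := Primrec.nat_lt.comp Primrec.snd Primrec.fst
    exact hR.listFilter.comp (Primrec.list_range.comp Primrec.fst) Primrec.snd
  refine Primrec.list_flatMap Primrec.list_range (Primrec.list_map hf ?_)
  exact Primrec.pair (Primrec.snd.comp Primrec.fst) Primrec.snd

/-- The string of the subgraph that the nodes marked by `b` induce in the graph with the string
`x` on `n` nodes. -/
def inducedString (n : ℕ) (b x : List Bool) : List Bool :=
  (natPairs n).filterMap fun q =>
    if b[q.1]? = some true ∧ b[q.2]? = some true then x[(natPairs n).idxOf q]? else none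

theorem primrec_inducedString :
    Primrec fun a : ℕ × List Bool × List Bool => inducedString a.1 a.2.1 a.2.2 := by
  refine Primrec.listFilterMap (primrec_natPairs.comp Primrec.fst) ?_
  have hb : Primrec fun a : (ℕ × List Bool × List Bool) × (ℕ × ℕ) => a.1.2.1 :=
    Primrec.fst.comp (Primrec.snd.comp Primrec.fst)
  refine Primrec.ite (PrimrecPred.and
    (Primrec.eq.comp (Primrec.list_getElem?.comp hb (Primrec.fst.comp Primrec.snd))
      (Primrec.const (some true)))
    (Primrec.eq.comp (Primrec.list_getElem?.comp hb (Primrec.snd.comp Primrec.snd))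
      (Primrec.const (some true)))) ?_ (Primrec.const none)
  convert Primrec.list_getElem?.comp (Primrec.snd.comp (Primrec.snd.comp Primrec.fst))
    (Primrec.list_idxOf.comp Primrec.snd (primrec_natPairs.comp (Primrec.fst.comp Primrec.fst))) using 4
  -- What remains is to identify two lawful `BEq` instances on `ℕ × ℕ`.
  exact lawful_beq_subsingleton _ _

/-- The number of node sets that induce the subgraph with the string `h` in the graph with the
string `x` on `n` nodes. -/
def stringOccurrences (n : ℕ) (h x : List Bool) : ℕ :=
  ((boolLists n).filter fun b => inducedString n b x = h).length

theorem primrec_stringOccurrences :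
    Primrec fun a : ℕ × List Bool × List Bool => stringOccurrences a.1 a.2.1 a.2.2 := by
  have hR : PrimrecRel fun (b : List Bool) (a : ℕ × List Bool × List Bool) =>
      inducedString a.1 b a.2.2 = a.2.1 :=
    Primrec.eq.comp (primrec_inducedString.comp ((Primrec.fst.comp Primrec.snd).pair
      (Primrec.fst.pair (Primrec.snd.comp (Primrec.snd.comp Primrec.snd)))))
      (Primrec.fst.comp (Primrec.snd.comp Primrec.snd))
  exact Primrec.list_length.comp
    (hR.listFilter.comp (primrec_boolLists.comp Primrec.fst) Primrec.id)

theorem stringOccurrences_le (n : ℕ) (h x : List Bool) :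
    stringOccurrences n h x ≤ (boolLists n).length :=
  List.length_filter_le _ _

/-- The strings of all graphs on `n` nodes in the order of increasing `stringOccurrences`. -/
def sortedStrings (n : ℕ) (h : List Bool) : List (List Bool) :=
  (List.range ((boolLists n).length + 1)).flatMap fun t =>
    (boolLists (natPairs n).length).filter fun x => stringOccurrences n h x = t

theorem primrec_sortedStrings : Primrec₂ sortedStrings := by
  refine Primrec.list_flatMap (Primrec.list_range.comp (Primrec.succ.comp
    (Primrec.list_length.comp (primrec_boolLists.comp Primrec.fst)))) ?_
  have hR : PrimrecRel fun (x : List Bool) (a : (ℕ × List Bool) × ℕ) =>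
      stringOccurrences a.1.1 a.1.2 x = a.2 :=
    Primrec.eq.comp (primrec_stringOccurrences.comp
      ((Primrec.fst.comp (Primrec.fst.comp Primrec.snd)).pair
        ((Primrec.snd.comp (Primrec.fst.comp Primrec.snd)).pair Primrec.fst)))
      (Primrec.snd.comp Primrec.snd)
  exact hR.listFilter.comp (primrec_boolLists.comp (Primrec.list_length.comp
    (primrec_natPairs.comp (Primrec.fst.comp Primrec.fst)))) Primrec.id

theorem mem_sortedStrings {n : ℕ} {h x : List Bool} :
    x ∈ sortedStrings n h ↔ x.length = (natPairs n).length := by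
  have := stringOccurrences_le n h x
  simp only [sortedStrings, List.mem_flatMap, List.mem_range, List.mem_filter, mem_boolLists,
    decide_eq_true_eq]
  exact ⟨fun ⟨_, _, h, _⟩ => h, fun hx => ⟨_, by omega, hx, rfl⟩⟩

theorem nodup_sortedStrings (n : ℕ) (h : List Bool) : (sortedStrings n h).Nodup := by
  refine List.nodup_flatMap.2 ⟨fun t _ => (nodup_boolLists _).filter _, ?_⟩
  refine List.nodup_range.imp fun {s t} hst => ?_
  simp only [Function.onFun, List.disjoint_left, List.mem_filter, decide_eq_true_eq]
  rintro x ⟨-, rfl⟩ ⟨-, h⟩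
  exact hst h

theorem pairwise_sortedStrings (n : ℕ) (h : List Bool) :
    (sortedStrings n h).Pairwise fun x x' =>
      stringOccurrences n h x ≤ stringOccurrences n h x' := by
  refine List.pairwise_flatMap.2 ⟨fun t _ => ?_, ?_⟩
  -- Within one block all counts equal `t`, so membership alone gives the inequality.
  · refine List.Pairwise.imp_of_mem (R := fun _ _ => True) (fun {x x'} hx hx' _ => ?_)
      (List.pairwise_of_forall fun _ _ => trivial)
    rw [List.mem_filter, decide_eq_true_eq] at hx hx'
    rw [hx.2, hx'.2]
  · refine List.pairwise_lt_range.imp fun {s t} hst x hx x' hx' => ?_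
    rw [List.mem_filter, decide_eq_true_eq] at hx hx'
    rw [hx.2, hx'.2]
    exact hst.le

/-- A string of a graph is described by a prefix program for `h` and the binary logarithm of the
number of strings with at least (at most) as many occurrences of `h`. -/
theorem exists_complexity_le_stringOccurrences {U V : Machine} (hU : U.IsUniversal)
    (hV : V.IsUniversalPrefix) : ∃ c : ℕ, ∀ (n : ℕ) (h x : List Bool) (s : Finset (List Bool)),
      x.length = (natPairs n).length → x ∈ s →
      ((∀ x' : List Bool, x'.length = (natPairs n).length →
        stringOccurrences n h x ≤ stringOccurrences n h x' → x' ∈ s) ∨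
      (∀ x' : List Bool, x'.length = (natPairs n).length →
        stringOccurrences n h x' ≤ stringOccurrences n h x → x' ∈ s)) →
      (U.complexity x (natToString n) : ℝ) ≤
        V.complexity h (natToString n) + Real.logb 2 s.card + c := by
  have hup : Primrec₂ fun y h : List Bool => sortedStrings (stringToNat y) h :=
    primrec_sortedStrings.comp (primrec_stringToNat.comp Primrec.fst) Primrec.snd
  obtain ⟨c₁, hc₁⟩ := Machine.exists_complexity_le_of_getElem? hU hV hup
  -- The reversed list starts with the graphs that have the most occurrences and serves the upper
  -- tail.
  obtain ⟨c₂, hc₂⟩ := Machine.exists_complexity_le_of_getElem? hU hV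
    (Primrec.list_reverse.comp hup).to₂
  -- The string of `i` has at most log(i + 1) bits, and i + 1 ≤ N, so no rounding term appears.
  have hlog : ∀ {i N : ℕ}, i < N → ((natToString i).length : ℝ) ≤ Real.logb 2 N := by
    intro i N hiN
    rw [Real.le_logb_iff_rpow_le one_lt_two (by exact_mod_cast (Nat.zero_le i).trans_lt hiN),
      Real.rpow_natCast]
    exact_mod_cast (two_pow_length_natToString_le i).trans hiN
  have key : ∀ (D : List Bool → List Bool → List (List Bool)) (c : ℕ)
      (r : List Bool → List Bool → Prop),
      (∀ (y h x : List Bool) (i : ℕ), (D y h)[i]? = some x →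
        U.complexity x y ≤ V.complexity h y + (natToString i).length + c) →
      ∀ (n : ℕ) (h x : List Bool) (s : Finset (List Bool)),
      (D (natToString n) h).Pairwise r → (D (natToString n) h).Nodup →
      x ∈ D (natToString n) h → x ∈ s → (∀ x' ∈ D (natToString n) h, r x' x → x' ∈ s) →
      (U.complexity x (natToString n) : ℝ) ≤
        V.complexity h (natToString n) + Real.logb 2 s.card + c := by
    intro D c r hc n h x s hr hn hx hxs hs
    obtain ⟨i, hi, hix⟩ := List.exists_getElem?_lt_card hr hn hx hs hxs
    have h1 := hc (natToString n) h x i hix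
    have h2 := hlog hi
    have h3 : (U.complexity x (natToString n) : ℝ) ≤ V.complexity h (natToString n) +
      (natToString i).length + c := by exact_mod_cast h1
    linarith
  refine ⟨max c₁ c₂, fun n h x s hx hxs hs => ?_⟩
  rw [Nat.cast_max]
  rcases hs with hs | hs
  · refine (key _ c₂ (fun a b => stringOccurrences n h b ≤ stringOccurrences n h a) hc₂ n h x s
      ?_ ?_ ?_ hxs ?_).trans (by gcongr; exact le_max_right _ _) <;>
      simp only [stringToNat_natToString]
    · exact List.pairwise_reverse.2 (pairwise_sortedStrings n h)
    · exact List.nodup_reverse.2 (nodup_sortedStrings n h)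
    · exact List.mem_reverse.2 (mem_sortedStrings.2 hx)
    · exact fun x' hx' => hs x' (mem_sortedStrings.1 (List.mem_reverse.1 hx'))
  · refine (key _ c₁ (fun a b => stringOccurrences n h a ≤ stringOccurrences n h b) hc₁ n h x s
      ?_ ?_ ?_ hxs ?_).trans (by gcongr; exact le_max_left _ _) <;>
      simp only [stringToNat_natToString]
    · exact pairwise_sortedStrings n h
    · exact nodup_sortedStrings n h
    · exact mem_sortedStrings.2 hx
    · exact fun x' hx' => hs x' (mem_sortedStrings.1 hx')

/-! ### The bounded differences inequality for fair coin tosses -/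

/-- Hoeffding's lemma for one fair coin: factor out the midpoint and use cosh x ≤ exp(x²/2) at x =
(a - b)/2. -/
theorem exp_add_exp_div_two_le (a b : ℝ) {c : ℝ} (hc : |a - b| ≤ c) :
    (Real.exp a + Real.exp b) / 2 ≤ Real.exp ((a + b) / 2 + c ^ 2 / 8) := by
  have h1 := Real.cosh_le_exp_half_sq ((a - b) / 2)
  have h2 : (Real.exp a + Real.exp b) / 2 = Real.exp ((a + b) / 2) * Real.cosh ((a - b) / 2) := by
    rw [Real.cosh_eq, mul_div_assoc', mul_add, ← Real.exp_add, ← Real.exp_add]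
    ring_nf
  have h3 : (a - b) ^ 2 ≤ c ^ 2 := sq_le_sq' (by linarith [neg_le_of_abs_le hc])
    (le_of_abs_le hc)
  rw [h2]
  refine (mul_le_mul_of_nonneg_left h1 (Real.exp_nonneg _)).trans ?_
  rw [← Real.exp_add]
  exact Real.exp_le_exp.2 (by nlinarith)

theorem sum_fin_succ_bool {m : ℕ} (g : (Fin (m + 1) → Bool) → ℝ) :
    ∑ x, g x = ∑ y : Fin m → Bool, (g (Fin.cons false y) + g (Fin.cons true y)) := by
  rw [← (Fin.consEquiv fun _ : Fin (m + 1) => Bool).sum_comp, Fintype.sum_prod_type_right]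
  refine Finset.sum_congr rfl fun y _ => ?_
  rw [Fintype.sum_bool, add_comm]
  rfl

/-- Averaging over the first coin keeps both the mean and the bound `c` on the differences, and by
Hoeffding's lemma it costs a factor exp(c²/8). Induction then removes the coins one by one. -/
theorem sum_exp_le_of_bounded_differences_fin {m : ℕ} (f : (Fin m → Bool) → ℝ) {c : ℝ}
    (hf : ∀ x i b, |f (Function.update x i b) - f x| ≤ c) :
    ∑ x, Real.exp (f x) ≤ 2 ^ m * Real.exp ((∑ x, f x) / 2 ^ m + m * c ^ 2 / 8) := by
  induction m with
  | zero => simp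
  | succ m ih =>
    have hcons : ∀ y : Fin m → Bool, |f (Fin.cons false y) - f (Fin.cons true y)| ≤ c := by
      intro y
      have := hf (Fin.cons true y) 0 false
      rwa [Fin.update_cons_zero] at this
    have hg := ih (fun y => (f (Fin.cons false y) + f (Fin.cons true y)) / 2) fun y i b => by
      have h1 := abs_le.1 (hf (Fin.cons false y) i.succ b)
      have h2 := abs_le.1 (hf (Fin.cons true y) i.succ b)
      rw [← Fin.cons_update] at h1 h2
      rw [abs_le]
      constructor <;> linarith [h1.1, h1.2, h2.1, h2.2]
    rw [← Finset.sum_div, ← sum_fin_succ_bool] at hg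
    rw [sum_fin_succ_bool fun x => Real.exp (f x)]
    calc ∑ y : Fin m → Bool, (Real.exp (f (Fin.cons false y)) + Real.exp (f (Fin.cons true y)))
        ≤ ∑ y : Fin m → Bool, 2 * (Real.exp ((f (Fin.cons false y) + f (Fin.cons true y)) / 2) *
            Real.exp (c ^ 2 / 8)) := by
          refine Finset.sum_le_sum fun y _ => ?_
          have := exp_add_exp_div_two_le _ _ (hcons y)
          rw [Real.exp_add] at this
          linarith
      _ = 2 * Real.exp (c ^ 2 / 8) * ∑ y : Fin m → Bool,
            Real.exp ((f (Fin.cons false y) + f (Fin.cons true y)) / 2) := by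
          rw [Finset.mul_sum]
          exact Finset.sum_congr rfl fun y _ => by ring
      _ ≤ 2 * Real.exp (c ^ 2 / 8) *
            (2 ^ m * Real.exp ((∑ x, f x) / 2 / 2 ^ m + m * c ^ 2 / 8)) := by
          gcongr
      _ = 2 ^ (m + 1) * Real.exp ((∑ x, f x) / 2 ^ (m + 1) + (m + 1 : ℕ) * c ^ 2 / 8) := by
          have : (∑ x, f x) / 2 ^ (m + 1) + (m + 1 : ℕ) * c ^ 2 / 8 =
              ((∑ x, f x) / 2 / 2 ^ m + m * c ^ 2 / 8) + c ^ 2 / 8 := by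
            rw [pow_succ', div_div, Nat.cast_succ]
            ring
          rw [this, Real.exp_add _ (c ^ 2 / 8), pow_succ]
          ring

theorem sum_exp_le_of_bounded_differences {ι : Type*} [Fintype ι] [DecidableEq ι]
    (f : (ι → Bool) → ℝ) {c : ℝ} (hf : ∀ x i b, |f (Function.update x i b) - f x| ≤ c) :
    ∑ x, Real.exp (f x) ≤ 2 ^ Fintype.card ι *
      Real.exp ((∑ x, f x) / 2 ^ Fintype.card ι + Fintype.card ι * c ^ 2 / 8) := by
  let e := (Fintype.equivFin ι).arrowCongr (Equiv.refl Bool)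
  have h := sum_exp_le_of_bounded_differences_fin (fun x => f (e.symm x)) (c := c) fun x i b => by
    have : e.symm (Function.update x i b) =
        Function.update (e.symm x) ((Fintype.equivFin ι).symm i) b := by
      ext j
      simp [e, Equiv.arrowCongr, Function.update_apply, Equiv.eq_symm_apply]
    simpa [this] using hf (e.symm x) ((Fintype.equivFin ι).symm i) b
  rwa [e.symm.sum_comp f, e.symm.sum_comp fun x => Real.exp (f x)] at h

/-- McDiarmid's inequality for fair coin tosses. -/
theorem card_le_of_bounded_differences {ι : Type*} [Fintype ι] [DecidableEq ι]
    (f : (ι → Bool) → ℝ) {c t : ℝ} (hc : 0 < c) (hι : 0 < Fintype.card ι) (ht : 0 ≤ t)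
    (hf : ∀ x i b, |f (Function.update x i b) - f x| ≤ c) :
    ((Finset.univ.filter fun x => (∑ x, f x) / 2 ^ Fintype.card ι + t ≤ f x).card : ℝ) ≤
      2 ^ Fintype.card ι * Real.exp (-(2 * t ^ 2 / (Fintype.card ι * c ^ 2))) := by
  set m := Fintype.card ι
  set μ := (∑ x, f x) / 2 ^ m
  have hm : (0 : ℝ) < m := by exact_mod_cast hι
  -- This value minimizes the exponent -lt + m(lc)²/8 of the Chernoff bound.
  set l := 4 * t / (m * c ^ 2) with hl
  have hl0 : 0 ≤ l := by positivity
  have h := sum_exp_le_of_bounded_differences (fun x => l * f x) (c := l * c) fun x i b => by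
    rw [← mul_sub, abs_mul, abs_of_nonneg hl0]
    exact mul_le_mul_of_nonneg_left (hf x i b) hl0
  rw [← Finset.mul_sum, mul_div_assoc] at h
  -- Markov's inequality for exp(l f).
  have h2 : ((Finset.univ.filter fun x => μ + t ≤ f x).card : ℝ) * Real.exp (l * (μ + t)) ≤
      ∑ x, Real.exp (l * f x) := by
    rw [← nsmul_eq_mul, ← Finset.sum_const]
    refine (Finset.sum_le_sum fun x hx => ?_).trans
      (Finset.sum_le_sum_of_subset_of_nonneg (Finset.subset_univ _) fun _ _ _ => Real.exp_nonneg _)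
    rw [Finset.mem_filter] at hx
    exact Real.exp_le_exp.2 (mul_le_mul_of_nonneg_left hx.2 hl0)
  have h3 := h2.trans h
  rw [← le_div_iff₀ (Real.exp_pos _), mul_div_assoc, ← Real.exp_sub] at h3
  refine h3.trans (le_of_eq ?_)
  congr 2
  change l * μ + m * (l * c) ^ 2 / 8 - l * (μ + t) = _
  rw [hl]
  field_simp
  ring

/-! ### Graphs, their edge strings and their edge indicators -/

/-- The pairs of nodes of a graph on `n` nodes. -/
abbrev NodePair (n : ℕ) : Type := {q : Fin n × Fin n // q.1 < q.2}

theorem card_nodePair (n : ℕ) : Fintype.card (NodePair n) = n.choose 2 := by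
  rw [Fintype.card_subtype, Finset.card_filter, Fintype.sum_prod_type]
  have h : ∀ i : Fin n, (∑ j : Fin n, if i < j then 1 else 0) = n - 1 - (i : ℕ) := by
    intro i
    rw [← Finset.card_filter, ← Fin.card_Ioi]
    congr 1
    ext j
    simp
  simp only [h]
  rw [Fin.sum_univ_eq_sum_range fun i => n - 1 - i, Finset.sum_range_reflect (fun i => i),
    Finset.sum_range_id, Nat.choose_two_right]

open Classical in
/-- A labeled graph is determined by the indicator function of its edges. -/
noncomputable def graphEquiv (n : ℕ) : SimpleGraph (Fin n) ≃ (NodePair n → Bool) where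
  toFun G q := decide (G.Adj q.1.1 q.1.2)
  invFun w :=
    { Adj := fun i j => (∃ h : i < j, w ⟨(i, j), h⟩ = true) ∨ ∃ h : j < i, w ⟨(j, i), h⟩ = true
      symm := ⟨fun _ _ h => h.symm⟩
      loopless := ⟨fun i h => by simp at h⟩ }
  left_inv G := by
    ext i j
    rcases lt_trichotomy i j with h | h | h
    · simp [h, h.not_gt]
    · simp [h]
    · simp [h, h.not_gt, G.adj_comm]
  right_inv w := by
    funext ⟨⟨i, j⟩, h⟩
    have h' : i < j := h
    simp [h', h'.not_gt]

theorem graphEquiv_symm_adj {n : ℕ} (w : NodePair n → Bool) {i j : Fin n} (h : i < j) :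
    ((graphEquiv n).symm w).Adj i j ↔ w ⟨(i, j), h⟩ = true := by
  simp [graphEquiv, h, h.not_gt]

theorem ext_of_lt {n : ℕ} {G G' : SimpleGraph (Fin n)}
    (h : ∀ i j, i < j → (G.Adj i j ↔ G'.Adj i j)) : G = G' := by
  ext i j
  rcases lt_trichotomy i j with hij | rfl | hij
  · exact h i j hij
  · simp
  · rw [G.adj_comm, G'.adj_comm, h j i hij]

/-- The pairs of nodes in lexicographic order. -/
def edgePairs (n : ℕ) : List (Fin n × Fin n) :=
  (List.finRange n).flatMap fun i => ((List.finRange n).filter fun j => i < j).map fun j => (i, j)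

theorem mem_edgePairs {n : ℕ} {q : Fin n × Fin n} : q ∈ edgePairs n ↔ q.1 < q.2 := by
  obtain ⟨i, j⟩ := q
  simp [edgePairs]

theorem pairwise_edgePairs (n : ℕ) :
    (edgePairs n).Pairwise fun q r => toLex q < toLex r := by
  have hlt : (List.finRange n).Pairwise (· < ·) := List.pairwise_lt_finRange n
  refine List.pairwise_flatMap.2 ⟨fun i _ => ?_, ?_⟩
  · refine List.pairwise_map.2 ((hlt.filter _).imp fun {a b} hab => ?_)
    exact Prod.Lex.toLex_lt_toLex.2 (.inr ⟨rfl, hab⟩)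
  · refine hlt.imp fun {i i'} hii' q hq q' hq' => ?_
    obtain ⟨j, -, rfl⟩ := List.mem_map.1 hq
    obtain ⟨j', -, rfl⟩ := List.mem_map.1 hq'
    exact Prod.Lex.toLex_lt_toLex.2 (.inl hii')

theorem nodup_edgePairs (n : ℕ) : (edgePairs n).Nodup :=
  (pairwise_edgePairs n).imp fun {a b} h hab => by simp [hab] at h

theorem length_edgePairs (n : ℕ) : (edgePairs n).length = n.choose 2 := by
  rw [← card_nodePair, ← List.toFinset_card_of_nodup (nodup_edgePairs n), Fintype.card_subtype]
  congr 1
  ext q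
  simp [mem_edgePairs]

theorem natPairs_eq_map_edgePairs (n : ℕ) :
    natPairs n = (edgePairs n).map fun q => ((q.1 : ℕ), (q.2 : ℕ)) := by
  rw [natPairs, edgePairs, List.map_flatMap, ← List.map_coe_finRange_eq_range, List.flatMap_map]
  refine List.flatMap_congr fun i _ => ?_
  rw [List.map_map, List.filter_map, List.map_map]
  rfl

theorem length_natPairs (n : ℕ) : (natPairs n).length = n.choose 2 := by
  rw [natPairs_eq_map_edgePairs, List.length_map, length_edgePairs]

open Classical in
theorem edgeString_eq_map {n : ℕ} (G : SimpleGraph (Fin n)) :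
    edgeString G = (edgePairs n).map fun q => decide (G.Adj q.1 q.2) := by
  rw [edgeString, edgePairs, List.map_flatMap]
  refine List.flatMap_congr fun i _ => ?_
  rw [List.map_map]
  rfl

theorem length_edgeString {n : ℕ} (G : SimpleGraph (Fin n)) :
    (edgeString G).length = n.choose 2 := by
  rw [edgeString_eq_map, List.length_map, length_edgePairs]

theorem edgeString_injective (n : ℕ) :
    Function.Injective (edgeString : SimpleGraph (Fin n) → List Bool) := by
  intro G G' h
  rw [edgeString_eq_map, edgeString_eq_map] at h
  refine ext_of_lt fun i j hij => ?_
  simpa using List.map_inj_left.1 h (i, j) (mem_edgePairs.2 hij)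

theorem exists_edgeString_eq {n : ℕ} {x : List Bool} (hx : x.length = n.choose 2) :
    ∃ G : SimpleGraph (Fin n), edgeString G = x := by
  classical
  refine ⟨(graphEquiv n).symm fun q => x.getD ((edgePairs n).idxOf q.1) false, ?_⟩
  rw [edgeString_eq_map]
  refine List.ext_getElem (by rw [List.length_map, length_edgePairs, hx]) fun i h1 h2 => ?_
  have h3 : i < (edgePairs n).length := by simpa using h1
  have h4 := mem_edgePairs.1 (List.getElem_mem h3)
  have h5 := graphEquiv_symm_adj (fun q => x.getD ((edgePairs n).idxOf q.1) false) h4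
  rw [List.getElem_map]
  simp only [Prod.mk.eta] at h5
  simp only [h5, (nodup_edgePairs n).idxOf_getElem i h3, Bool.decide_eq_true]
  exact List.getD_eq_getElem _ _ h2

/-- The increasing enumeration of `S` preserves the lexicographic order. Both lists are strictly
sorted and have the same members, so they coincide. -/
theorem edgePairs_filter_mem {n : ℕ} (S : Finset (Fin n)) :
    ((edgePairs n).filter fun q => q.1 ∈ S ∧ q.2 ∈ S) =
      (edgePairs S.card).map fun q => (S.orderEmbOfFin rfl q.1, S.orderEmbOfFin rfl q.2) := by
  have hr : ∀ i, i ∈ S ↔ ∃ a, S.orderEmbOfFin rfl a = i := by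
    intro i
    rw [← Set.mem_range, Finset.range_orderEmbOfFin, Finset.mem_coe]
  have h1 := (pairwise_edgePairs n).filter fun q => decide (q.1 ∈ S ∧ q.2 ∈ S)
  have h2 : ((edgePairs S.card).map fun q =>
      (S.orderEmbOfFin rfl q.1, S.orderEmbOfFin rfl q.2)).Pairwise
      fun q r => toLex q < toLex r := by
    refine List.pairwise_map.2 ((pairwise_edgePairs _).imp fun {q r} h => ?_)
    rw [Prod.Lex.toLex_lt_toLex] at h ⊢
    simpa using h
  have : Std.Irrefl fun q r : Fin n × Fin n => toLex q < toLex r := ⟨fun q => lt_irrefl _⟩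
  have : Std.Asymm fun q r : Fin n × Fin n => toLex q < toLex r := ⟨fun q r => lt_asymm⟩
  refine h1.eq_of_mem_iff h2 fun q => ?_
  obtain ⟨i, j⟩ := q
  simp only [List.mem_filter, mem_edgePairs, decide_eq_true_eq, List.mem_map, Prod.mk.injEq]
  constructor
  · rintro ⟨hij, hi, hj⟩
    obtain ⟨a, rfl⟩ := (hr i).1 hi
    obtain ⟨b, rfl⟩ := (hr j).1 hj
    exact ⟨(a, b), by simpa using hij, rfl, rfl⟩
  · rintro ⟨⟨a, b⟩, hab, rfl, rfl⟩
    exact ⟨by simpa using hab, (hr _).2 ⟨a, rfl⟩, (hr _).2 ⟨b, rfl⟩⟩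

theorem List.getElem?_map_idxOf_map {α β γ : Type*} [DecidableEq β] {l : List α} (g : α → γ)
    {φ : α → β} (hφ : Function.Injective φ) {a : α} (ha : a ∈ l) :
    (l.map g)[(l.map φ).idxOf (φ a)]? = some (g a) := by
  have h1 := List.getElem?_idxOf (List.mem_map_of_mem (f := φ) ha)
  rw [List.getElem?_map, Option.map_eq_some_iff] at h1
  obtain ⟨b, hb, hba⟩ := h1
  rw [List.getElem?_map, hb, hφ hba]
  rfl

/-- Since relabeling is monotone, discarding the bits of the pairs not contained in `S` already
leaves the edge string of the relabeled subgraph in the right order. -/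
theorem inducedString_edgeString {n : ℕ} (G : SimpleGraph (Fin n)) (S : Finset (Fin n)) :
    inducedString n (List.ofFn fun i => decide (i ∈ S)) (edgeString G) =
      edgeString (G.comap (S.orderEmbOfFin rfl)) := by
  classical
  have hφ : Function.Injective fun q : Fin n × Fin n => ((q.1 : ℕ), (q.2 : ℕ)) := by
    rintro ⟨a, b⟩ ⟨a', b'⟩ h
    simpa [Fin.ext_iff] using h
  have h1 : inducedString n (List.ofFn fun i => decide (i ∈ S)) (edgeString G) =
      (edgePairs n).filterMap fun q =>
        if q.1 ∈ S ∧ q.2 ∈ S then some (decide (G.Adj q.1 q.2)) else none := by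
    rw [inducedString, natPairs_eq_map_edgePairs, List.filterMap_map]
    refine List.filterMap_congr fun q hq => ?_
    rw [edgeString_eq_map]
    have h2 := List.getElem?_map_idxOf_map (fun q => decide (G.Adj q.1 q.2)) hφ hq
    have h3 : ∀ i : Fin n, (List.ofFn fun i => decide (i ∈ S))[(i : ℕ)]? = some true ↔ i ∈ S := by
      intro i
      simp
    simp only [Function.comp, h3]
    split_ifs
    · convert h2
    · rfl
  have h4 : edgeString (G.comap (S.orderEmbOfFin rfl)) = ((edgePairs S.card).map fun q =>
      (S.orderEmbOfFin rfl q.1, S.orderEmbOfFin rfl q.2)).map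
        fun q => decide (G.Adj q.1 q.2) := by
    rw [edgeString_eq_map, List.map_map]
    rfl
  rw [h1, h4, ← edgePairs_filter_mem, ← List.filterMap_eq_map, List.filterMap_filter]
  refine List.filterMap_congr fun q _ => ?_
  simp

/-- An edge string records the number of nodes only through its length. Graphs on 0 and on 1 nodes
share the empty string, which is why `k = 1` is treated separately. -/
theorem choose_two_injective {j k : ℕ} (hk : 2 ≤ k) (h : j.choose 2 = k.choose 2) : j = k := by
  have key : ∀ a b : ℕ, 2 ≤ b → a < b → a.choose 2 < b.choose 2 := by
    intro a b hb hab
    rcases Nat.eq_zero_or_pos a with rfl | ha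
    · exact Nat.choose_pos hb
    · have h1 := Nat.choose_le_choose 2 (Nat.succ_le_of_lt hab)
      rw [Nat.succ_eq_add_one, Nat.choose_succ_succ' a 1, Nat.choose_one_right] at h1
      norm_num at h1
      omega
  rcases lt_trichotomy j k with hj | hj | hj
  · exact absurd h (key _ _ hk hj).ne
  · exact hj
  · exact absurd h (key _ _ (hk.trans hj.le) hj).ne'

theorem isOccurrence_iff_inducedString {n k : ℕ} (hk : 2 ≤ k) (H : SimpleGraph (Fin k))
    (G : SimpleGraph (Fin n)) (S : Finset (Fin n)) :
    IsOccurrence H G S ↔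
      inducedString n (List.ofFn fun i => decide (i ∈ S)) (edgeString G) = edgeString H := by
  rw [inducedString_edgeString]
  constructor
  · rintro ⟨rfl, h⟩
    congr 1
    ext a b
    exact h a b
  · intro h
    have hl := congrArg List.length h
    rw [length_edgeString, length_edgeString] at hl
    obtain rfl := choose_two_injective hk hl
    refine ⟨rfl, fun a b => ?_⟩
    rw [← edgeString_injective _ h]
    rfl

/-- Node sets correspond to their indicator strings. This links the count that a machine computes to
the count in the theorem. -/
theorem stringOccurrences_edgeString {n k : ℕ} (hk : 2 ≤ k) (H : SimpleGraph (Fin k))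
    (G : SimpleGraph (Fin n)) :
    stringOccurrences n (edgeString H) (edgeString G) = occurrences H G := by
  classical
  rw [stringOccurrences, ← List.toFinset_card_of_nodup ((nodup_boolLists n).filter _), occurrences]
  symm
  refine Finset.card_bij (fun S _ => List.ofFn fun i => decide (i ∈ S)) ?_ ?_ ?_
  · intro S hS
    rw [Finset.mem_filter] at hS
    simpa [mem_boolLists] using (isOccurrence_iff_inducedString hk H G S).1 hS.2
  · intro S _ S' _ h
    ext i
    simpa using congrFun (List.ofFn_injective h) i
  · intro b hb
    rw [List.mem_toFinset, List.mem_filter, mem_boolLists, decide_eq_true_eq] at hb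
    obtain ⟨rfl, hb⟩ := hb
    have : (List.ofFn fun i => decide (i ∈ Finset.univ.filter fun i => b.get i = true)) = b := by
      simp
    refine ⟨_, ?_, this⟩
    rw [Finset.mem_filter, isOccurrence_iff_inducedString hk, this]
    exact ⟨Finset.mem_univ _, hb⟩

/-! ### Occurrences in a random graph -/

/-- The condition fixes one bit at each position in the range of `ι` and leaves all other bits free.
-/
theorem card_eq_on_range {α β : Type*} [Fintype α] [Fintype β] [DecidableEq β] {ι : α → β}
    (hι : Function.Injective ι) (g : α → Bool) :
    (Finset.univ.filter fun w : β → Bool => ∀ a, w (ι a) = g a).card * 2 ^ Fintype.card α =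
      2 ^ Fintype.card β := by
  classical
  set s : Finset β := Finset.univ.image ι with hs
  have hcard : s.card = Fintype.card α := by
    rw [hs, Finset.card_image_of_injective _ hι, Finset.card_univ]
  have h : (Finset.univ.filter fun w : β → Bool => ∀ a, w (ι a) = g a) =
      Fintype.piFinset fun b => if b ∈ s then {Function.extend ι g (fun _ => false) b}
        else Finset.univ := by
    ext w
    simp only [Finset.mem_filter, Finset.mem_univ, true_and, Fintype.mem_piFinset]
    constructor
    · intro hw b
      split_ifs with hb
      · obtain ⟨a, -, rfl⟩ := Finset.mem_image.1 hb
        rw [hι.extend_apply, hw, Finset.mem_singleton]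
      · exact Finset.mem_univ _
    · intro hw a
      have := hw (ι a)
      rwa [if_pos (Finset.mem_image_of_mem _ (Finset.mem_univ a)), Finset.mem_singleton,
        hι.extend_apply] at this
  have h2 : ∀ b, (if b ∈ s then {Function.extend ι g (fun _ => false) b}
      else (Finset.univ : Finset Bool)).card = if b ∈ s then 1 else 2 := by
    intro b
    split_ifs <;> rfl
  rw [h, Fintype.card_piFinset]
  simp only [h2]
  rw [Finset.prod_ite, Finset.prod_const_one, one_mul, Finset.prod_const, ← pow_add, ← hcard]
  congr 1
  have h3 : (Finset.univ.filter fun b => b ∉ s) = sᶜ := by ext; simp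
  rw [h3, add_comm, Finset.card_add_card_compl]

theorem isOccurrence_iff_of_card {n k : ℕ} {H : SimpleGraph (Fin k)} {G : SimpleGraph (Fin n)}
    {S : Finset (Fin n)} (hS : S.card = k) :
    IsOccurrence H G S ↔ ∀ q : NodePair k, graphEquiv n G
      ⟨(S.orderEmbOfFin hS q.1.1, S.orderEmbOfFin hS q.1.2), by simpa using q.2⟩ =
        graphEquiv k H q := by
  have h : IsOccurrence H G S ↔ G.comap (S.orderEmbOfFin hS) = H := by
    constructor
    · rintro ⟨_, h⟩
      ext a b
      exact h a b
    · rintro rfl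
      exact ⟨hS, fun a b => Iff.rfl⟩
  rw [h]
  constructor
  · rintro rfl q
    rfl
  · intro h
    refine ext_of_lt fun a b hab => ?_
    have := h ⟨(a, b), hab⟩
    simpa [graphEquiv] using this

open Classical in
theorem card_isOccurrence {n k : ℕ} (H : SimpleGraph (Fin k)) {S : Finset (Fin n)}
    (hS : S.card = k) :
    (Finset.univ.filter fun w : NodePair n → Bool =>
      IsOccurrence H ((graphEquiv n).symm w) S).card * 2 ^ k.choose 2 = 2 ^ n.choose 2 := by
  have hι : Function.Injective fun q : NodePair k =>
      (⟨(S.orderEmbOfFin hS q.1.1, S.orderEmbOfFin hS q.1.2), by simpa using q.2⟩ :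
        NodePair n) := by
    rintro ⟨⟨a, b⟩, h⟩ ⟨⟨a', b'⟩, h'⟩ heq
    simpa using heq
  rw [← card_nodePair, ← card_nodePair, ← card_eq_on_range hι (graphEquiv k H)]
  congr 2
  ext w
  simp only [Finset.mem_filter, Finset.mem_univ, true_and]
  rw [isOccurrence_iff_of_card hS, Equiv.apply_symm_apply]

/-- The average number of occurrences of `H` in a graph on `n` nodes. -/
theorem average_occurrences {n k : ℕ} (H : SimpleGraph (Fin k)) :
    (∑ w : NodePair n → Bool, (occurrences H ((graphEquiv n).symm w) : ℝ)) /
      2 ^ Fintype.card (NodePair n) = n.choose k * subgraphProb k := by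
  classical
  have h1 : (∑ w : NodePair n → Bool, occurrences H ((graphEquiv n).symm w)) *
      2 ^ k.choose 2 = n.choose k * 2 ^ n.choose 2 := by
    simp only [occurrences, Finset.card_filter]
    -- Linearity of expectation: count, for each node set, the graphs in which it is an occurrence.
    rw [Finset.sum_comm]
    simp only [← Finset.card_filter]
    have h2 : ∀ S : Finset (Fin n), S ∉ Finset.powersetCard k Finset.univ →
        (Finset.univ.filter fun w : NodePair n → Bool =>
          IsOccurrence H ((graphEquiv n).symm w) S).card = 0 := by
      intro S hS
      rw [Finset.card_eq_zero, Finset.filter_eq_empty_iff]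
      rintro w - ⟨h, -⟩
      exact hS (Finset.mem_powersetCard.2 ⟨Finset.subset_univ _, h⟩)
    rw [← Finset.sum_subset (Finset.subset_univ (Finset.powersetCard k Finset.univ))
      fun S _ hS => h2 S hS, Finset.sum_mul,
      Finset.sum_congr rfl fun S hS => card_isOccurrence H (Finset.mem_powersetCard.1 hS).2,
      Finset.sum_const, Finset.card_powersetCard, Finset.card_univ, Fintype.card_fin,
      smul_eq_mul]
  have h3 : (∑ w : NodePair n → Bool, (occurrences H ((graphEquiv n).symm w) : ℝ)) *
      2 ^ k.choose 2 = n.choose k * 2 ^ n.choose 2 := by exact_mod_cast h1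
  rw [card_nodePair, subgraphProb, ← div_eq_mul_inv, div_eq_div_iff (by positivity)
    (by positivity), h3]

theorem occurrences_le_choose {n k : ℕ} (H : SimpleGraph (Fin k)) (G : SimpleGraph (Fin n)) :
    occurrences H G ≤ n.choose k := by
  classical
  have h : (Finset.powersetCard k (Finset.univ : Finset (Fin n))).card = n.choose k := by
    rw [Finset.card_powersetCard, Finset.card_univ, Fintype.card_fin]
  rw [← h, occurrences]
  refine Finset.card_le_card fun S hS => ?_
  obtain ⟨h, -⟩ := (Finset.mem_filter.1 hS).2
  exact Finset.mem_powersetCard.2 ⟨Finset.subset_univ _, h⟩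

/-! ### Sensitivity of the number of occurrences to a single edge. -/

theorem card_superset_pair_le {n k : ℕ} {i j : Fin n} (hij : i ≠ j) :
    (Finset.univ.filter fun S : Finset (Fin n) => S.card = k ∧ i ∈ S ∧ j ∈ S).card ≤
      (n - 2).choose (k - 2) := by
  have h2 : ({i, j} : Finset (Fin n)).card = 2 := Finset.card_pair hij
  have h : (Finset.powersetCard (k - 2) ({i, j}ᶜ : Finset (Fin n))).card =
      (n - 2).choose (k - 2) := by
    rw [Finset.card_powersetCard, Finset.card_compl, h2, Fintype.card_fin]
  have hsub : ∀ S : Finset (Fin n), i ∈ S ∧ j ∈ S → ({i, j} : Finset (Fin n)) ⊆ S := by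
    rintro S ⟨hi, hj⟩
    simp [Finset.insert_subset_iff, hi, hj]
  rw [← h]
  refine Finset.card_le_card_of_injOn (fun S => S \ {i, j}) ?_ ?_
  · intro S hS
    obtain ⟨hc, hS⟩ := (Finset.mem_filter.1 (Finset.mem_coe.1 hS)).2
    refine Finset.mem_coe.2 (Finset.mem_powersetCard.2 ⟨?_, ?_⟩)
    · intro a ha
      exact Finset.mem_compl.2 (Finset.mem_sdiff.1 ha).2
    · rw [Finset.card_sdiff_of_subset (hsub S hS), h2, hc]
  · intro S hS S' hS' heq
    have h1 := hsub S (Finset.mem_filter.1 (Finset.mem_coe.1 hS)).2.2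
    have h1' := hsub S' (Finset.mem_filter.1 (Finset.mem_coe.1 hS')).2.2
    rw [← Finset.sdiff_union_of_subset h1, ← Finset.sdiff_union_of_subset h1']
    exact congrArg (· ∪ _) heq

/-- A set that misses an endpoint of `q` induces the same subgraph in both graphs, so only the sets
of size `k` containing both endpoints can be lost. -/
theorem occurrences_le_add {n k : ℕ} (H : SimpleGraph (Fin k))
    {G G' : SimpleGraph (Fin n)} {q : NodePair n}
    (h : ∀ r, r ≠ q → graphEquiv n G r = graphEquiv n G' r) :
    occurrences H G ≤ occurrences H G' + (n - 2).choose (k - 2) := by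
  classical
  refine le_trans ?_ (Nat.add_le_add_left (card_superset_pair_le q.2.ne) _)
  rw [occurrences, occurrences]
  refine le_trans (Finset.card_le_card ?_) (Finset.card_union_le _ _)
  intro S hS
  have hS := (Finset.mem_filter.1 hS).2
  obtain ⟨hc, -⟩ := id hS
  rw [Finset.mem_union, Finset.mem_filter, Finset.mem_filter]
  by_cases hq : q.1.1 ∈ S ∧ q.1.2 ∈ S
  · exact .inr ⟨Finset.mem_univ _, hc, hq⟩
  · refine .inl ⟨Finset.mem_univ _, ?_⟩
    rw [isOccurrence_iff_of_card hc] at hS ⊢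
    intro r
    rw [← hS r]
    refine (h _ ?_).symm
    rintro rfl
    exact hq ⟨Finset.orderEmbOfFin_mem _ _ _, Finset.orderEmbOfFin_mem _ _ _⟩

theorem abs_occurrences_update_sub_le {n k : ℕ} (H : SimpleGraph (Fin k))
    (w : NodePair n → Bool) (q : NodePair n) (b : Bool) :
    |(occurrences H ((graphEquiv n).symm (Function.update w q b)) : ℝ) -
      occurrences H ((graphEquiv n).symm w)| ≤ (n - 2).choose (k - 2) := by
  have h1 := occurrences_le_add H (G := (graphEquiv n).symm (Function.update w q b))
    (G' := (graphEquiv n).symm w) (q := q) fun r hr => by simp [hr]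
  have h2 := occurrences_le_add H (G' := (graphEquiv n).symm (Function.update w q b))
    (G := (graphEquiv n).symm w) (q := q) fun r hr => by simp [hr]
  have h1' : (occurrences H ((graphEquiv n).symm (Function.update w q b)) : ℝ) ≤
    occurrences H ((graphEquiv n).symm w) + (n - 2).choose (k - 2) := by exact_mod_cast h1
  have h2' : (occurrences H ((graphEquiv n).symm w) : ℝ) ≤
    occurrences H ((graphEquiv n).symm (Function.update w q b)) + (n - 2).choose (k - 2) := by
      exact_mod_cast h2
  rw [abs_le]
  constructor <;> linarith

/-- Both tails of the number of occurrences in a random graph; `σ` is `1` or `-1`. -/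
theorem card_occurrences_tail_le {n k : ℕ} (hk : 2 ≤ k) (hkn : k ≤ n) (H : SimpleGraph (Fin k))
    {σ t : ℝ} (hσ : |σ| = 1) (ht : 0 ≤ t) :
    ((Finset.univ.filter fun w : NodePair n → Bool =>
      σ * (n.choose k * subgraphProb k) + t ≤
        σ * occurrences H ((graphEquiv n).symm w)).card : ℝ) ≤
      2 ^ n.choose 2 *
        Real.exp (-(2 * t ^ 2 / (n.choose 2 * ((n - 2).choose (k - 2) : ℝ) ^ 2))) := by
  have h := card_le_of_bounded_differences
    (fun w : NodePair n → Bool => σ * occurrences H ((graphEquiv n).symm w))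
    (c := (n - 2).choose (k - 2)) (t := t) (by exact_mod_cast Nat.choose_pos (by omega))
    (by rw [card_nodePair]; exact Nat.choose_pos (by omega)) ht fun w q b => by
      rw [← mul_sub, abs_mul, hσ, one_mul]
      exact abs_occurrences_update_sub_le H w q b
  rwa [← Finset.mul_sum, mul_div_assoc, average_occurrences, card_nodePair] at h

/-- A graph in which the number of occurrences of `H` deviates from the average has a short
description. -/
theorem exists_complexity_le_of_deviation {U V : Machine} (hU : U.IsUniversal)
    (hV : V.IsUniversalPrefix) : ∃ c : ℕ, ∀ (n k : ℕ) (G : SimpleGraph (Fin n))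
      (H : SimpleGraph (Fin k)), 2 ≤ k → k ≤ n →
      (U.complexity (edgeString G) (natToString n) : ℝ) ≤
        V.complexity (edgeString H) (natToString n) + n.choose 2 -
          2 * ((occurrences H G : ℝ) - n.choose k * subgraphProb k) ^ 2 /
            (n.choose 2 * ((n - 2).choose (k - 2) : ℝ) ^ 2) * Real.logb 2 (Real.exp 1) + c := by
  classical
  obtain ⟨c, hc⟩ := exists_complexity_le_stringOccurrences hU hV
  refine ⟨c, fun n k G H hk hkn => ?_⟩
  set d := (occurrences H G : ℝ) - n.choose k * subgraphProb k with hd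
  -- The sign of the deviation selects the tail that contains `G`.
  obtain ⟨σ, hσ, hσd⟩ : ∃ σ : ℝ, (σ = 1 ∨ σ = -1) ∧ σ * d = |d| := by
    rcases abs_cases d with h | h
    · exact ⟨1, .inl rfl, by rw [h.1, one_mul]⟩
    · exact ⟨-1, .inr rfl, by rw [h.1, neg_one_mul]⟩
  have hσ1 : |σ| = 1 := by rcases hσ with rfl | rfl <;> simp
  set A := Finset.univ.filter fun w : NodePair n → Bool =>
      σ * (n.choose k * subgraphProb k) + |d| ≤
        σ * occurrences H ((graphEquiv n).symm w) with hA
  set s := A.image fun w => edgeString ((graphEquiv n).symm w) with hs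
  -- With threshold |d| the tail begins exactly at the count of `G`, so `s` contains all graphs that
  -- are at least as extreme on its side.
  have hmem : ∀ G' : SimpleGraph (Fin n), edgeString G' ∈ s ↔
      σ * (occurrences H G : ℝ) ≤ σ * occurrences H G' := by
    intro G'
    have h1 : σ * (occurrences H G : ℝ) = σ * (n.choose k * subgraphProb k) + |d| := by
      rw [← hσd, hd]; ring
    rw [h1, hs, Finset.mem_image]
    constructor
    · rintro ⟨w, hw, hwG⟩
      rw [← edgeString_injective n hwG]
      exact (Finset.mem_filter.1 hw).2
    · intro h
      exact ⟨graphEquiv n G', by simpa [hA] using h, by simp⟩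
  have hGs : edgeString G ∈ s := (hmem G).2 le_rfl
  have hbound := hc n (edgeString H) (edgeString G) s
    (by rw [length_edgeString, length_natPairs]) hGs (by
      rcases hσ with rfl | rfl
      · refine .inl fun x hx hGx => ?_
        obtain ⟨G', rfl⟩ := exists_edgeString_eq (hx.trans (length_natPairs n))
        rw [stringOccurrences_edgeString hk, stringOccurrences_edgeString hk] at hGx
        rw [hmem, one_mul, one_mul]
        exact_mod_cast hGx
      · refine .inr fun x hx hGx => ?_
        obtain ⟨G', rfl⟩ := exists_edgeString_eq (hx.trans (length_natPairs n))
        rw [stringOccurrences_edgeString hk, stringOccurrences_edgeString hk] at hGx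
        rw [hmem, neg_one_mul, neg_one_mul, neg_le_neg_iff]
        exact_mod_cast hGx)
  have hcard : (s.card : ℝ) ≤ 2 ^ n.choose 2 *
      Real.exp (-(2 * d ^ 2 / (n.choose 2 * ((n - 2).choose (k - 2) : ℝ) ^ 2))) := by
    rw [← sq_abs d]
    exact le_trans (by exact_mod_cast Finset.card_image_le)
      (card_occurrences_tail_le hk hkn H hσ1 (abs_nonneg d))
  have hpos : (0 : ℝ) < s.card := by exact_mod_cast Finset.card_pos.2 ⟨_, hGs⟩
  have hlog := Real.logb_le_logb_of_le one_lt_two hpos hcard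
  rw [Real.logb_mul (by positivity) (Real.exp_ne_zero _), Real.logb_pow,
    Real.logb_self_eq_one one_lt_two, mul_one] at hlog
  have hexp : ∀ x : ℝ, Real.logb 2 (Real.exp x) = x * Real.logb 2 (Real.exp 1) := by
    intro x
    rw [Real.logb, Real.logb, Real.log_exp, Real.log_exp, mul_one_div]
  rw [hexp] at hlog
  linarith

/-! ### The bound on the deviation -/

theorem subgraphProb_pos (k : ℕ) : 0 < subgraphProb k := by
  unfold subgraphProb
  positivity

theorem subgraphProb_le_one (k : ℕ) : subgraphProb k ≤ 1 :=
  inv_le_one_of_one_le₀ (one_le_pow₀ one_le_two)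

/-- The hypothesis says 2^(k²) ≤ n², and k² = 2 C(k,2) + k. Squares avoid the factor 2^(k/2). -/
theorem two_pow_sq_le {n k : ℕ} (hn : 0 < n) (h : (k : ℝ) ≤ √(2 * Real.logb 2 n)) (hk : 0 < k) :
    (2 ^ k.choose 2) ^ 2 * 2 ^ k ≤ n ^ 2 := by
  have hn' : (0 : ℝ) < n := by exact_mod_cast hn
  have h1 := (Real.le_sqrt' (by exact_mod_cast hk)).1 h
  have h2 : Real.logb 2 ((n : ℝ) ^ 2) = 2 * Real.logb 2 n := by rw [Real.logb_pow]; norm_num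
  rw [← h2, Real.le_logb_iff_rpow_le one_lt_two (by positivity)] at h1
  have h3 : ((2 : ℝ) ^ (k ^ 2)) ≤ n ^ 2 := by
    rw [← Real.rpow_natCast 2 (k ^ 2)]
    exact_mod_cast h1
  have h4 : (2 ^ k.choose 2) ^ 2 * 2 ^ k = 2 ^ (k ^ 2) := by
    rw [← pow_mul, ← pow_add, Nat.choose_two_right,
      Nat.div_mul_cancel (Nat.even_mul_pred_self k).two_dvd]
    congr 1
    obtain ⟨j, rfl⟩ := Nat.exists_eq_succ_of_ne_zero hk.ne'
    rw [Nat.succ_sub_one, Nat.succ_eq_add_one]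
    ring
  rw [h4]
  exact_mod_cast h3

theorem choose_two_le_mul_self (k : ℕ) : k.choose 2 ≤ k * k := by
  rw [Nat.choose_two_right]
  exact (Nat.div_le_self _ _).trans (Nat.mul_le_mul_left _ (Nat.sub_le _ _))

/-- Since k⁶/2^k tends to 0, the spare factor 2^k of `two_pow_sq_le` absorbs k⁶ up to 36 = 6² once k
≥ K. For k < K the left side is bounded by a constant, which is taken as N. -/
theorem exists_forall_cube_mul_le : ∃ N : ℕ, ∀ n k : ℕ, N ≤ n → 0 < n → 0 < k →
    (k : ℝ) ≤ √(2 * Real.logb 2 n) → k ^ 3 * 2 ^ k.choose 2 ≤ 6 * n := by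
  have h1 := (tendsto_pow_const_div_const_pow_of_one_lt 6 (one_lt_two (α := ℝ))).eventually
    (ge_mem_nhds (show (0 : ℝ) < 36 by norm_num))
  obtain ⟨K, hK⟩ := Filter.eventually_atTop.1 h1
  refine ⟨K ^ 3 * 2 ^ (K * K), fun n k hn hn0 hk hkn => ?_⟩
  rcases le_or_gt K k with h | h
  · have h2 := (div_le_iff₀ (by positivity)).1 (hK k h)
    have h3 : k ^ 6 ≤ 36 * 2 ^ k := by exact_mod_cast h2
    refine (Nat.pow_le_pow_iff_left two_ne_zero).1 ?_
    calc (k ^ 3 * 2 ^ k.choose 2) ^ 2 = k ^ 6 * (2 ^ k.choose 2) ^ 2 := by ring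
      _ ≤ 36 * 2 ^ k * (2 ^ k.choose 2) ^ 2 := Nat.mul_le_mul_right _ h3
      _ = 36 * ((2 ^ k.choose 2) ^ 2 * 2 ^ k) := by ring
      _ ≤ 36 * n ^ 2 := Nat.mul_le_mul_left _ (two_pow_sq_le hn0 hkn hk)
      _ = (6 * n) ^ 2 := by ring
  · have h2 : k ^ 3 * 2 ^ k.choose 2 ≤ K ^ 3 * 2 ^ (K * K) :=
      Nat.mul_le_mul (Nat.pow_le_pow_left h.le 3) (Nat.pow_le_pow_right two_pos
        ((choose_two_le_mul_self k).trans (Nat.mul_le_mul h.le h.le)))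
    omega

/-- Double counting of pairs inside node sets of size k expresses C(n-2,k-2) through C(n,k). The
claim reduces to k(k-1)² 2^C(k,2) ≤ 12(n-1), and 6n ≤ 12(n-1) for n ≥ 2. -/
theorem choose_two_mul_sq_le {n k : ℕ} (hk : 2 ≤ k) (hkn : k ≤ n)
    (h : k ^ 3 * 2 ^ k.choose 2 ≤ 6 * n) :
    (n.choose 2 : ℝ) * ((n - 2).choose (k - 2) : ℝ) ^ 2 ≤
      6 * (n.choose k : ℝ) ^ 2 * ((k : ℝ) / n * subgraphProb k) := by
  have h1 : (n.choose k : ℝ) * k.choose 2 = n.choose 2 * (n - 2).choose (k - 2) := by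
    exact_mod_cast Nat.choose_mul (n := n) hk
  have h2 : (k : ℝ) ^ 3 * 2 ^ k.choose 2 ≤ 6 * n := by exact_mod_cast h
  have hn2 : (2 : ℝ) ≤ n := by exact_mod_cast hk.trans hkn
  have hk2 : (2 : ℝ) ≤ k := by exact_mod_cast hk
  rw [Nat.cast_choose_two, Nat.cast_choose_two] at h1
  rw [Nat.cast_choose_two, subgraphProb]
  set q : ℝ := 2 ^ k.choose 2 with hq
  have hq0 : 0 < q := by positivity
  set B := (n.choose k : ℝ)
  set D := ((n - 2).choose (k - 2) : ℝ)
  have hD : D = B * (k * (k - 1)) / (n * (n - 1)) := by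
    rw [eq_div_iff (by nlinarith)]
    linarith
  have h3 : (k : ℝ) * (k - 1) ^ 2 * q ≤ 12 * (n - 1) := by
    have : (k : ℝ) * (k - 1) ^ 2 * q ≤ k ^ 3 * q := by
      refine mul_le_mul_of_nonneg_right ?_ hq0.le
      nlinarith
    linarith
  have hn1 : (0 : ℝ) < n - 1 := by linarith
  have hn0 : (0 : ℝ) < n := by linarith
  calc (n : ℝ) * (n - 1) / 2 * D ^ 2
      = B ^ 2 * k * (k * (k - 1) ^ 2 * q) / (2 * n * (n - 1) * q) := by
        rw [hD]; field_simp
    _ ≤ B ^ 2 * k * (12 * (n - 1)) / (2 * n * (n - 1) * q) := by gcongr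
    _ = 6 * B ^ 2 * (k / n * q⁻¹) := by field_simp; ring

theorem logb_exp_one_pos : 0 < Real.logb 2 (Real.exp 1) :=
  Real.logb_pos one_lt_two (Real.one_lt_exp_iff.2 one_pos)

/-- Ensures that the factor 3/log e in α is at least 1, so that the additive constant survives for
small `n`. -/
theorem logb_exp_one_le : Real.logb 2 (Real.exp 1) ≤ 3 := by
  rw [Real.logb_le_iff_le_rpow one_lt_two (Real.exp_pos 1)]
  have := Real.exp_one_lt_d9
  norm_num
  linarith

theorem occurrences_eq_of_one {n : ℕ} (H : SimpleGraph (Fin 1)) (G : SimpleGraph (Fin n)) :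
    occurrences H G = n := by
  classical
  have h : (Finset.powersetCard 1 (Finset.univ : Finset (Fin n))).card = n := by
    rw [Finset.card_powersetCard, Finset.card_univ, Fintype.card_fin, Nat.choose_one_right]
  refine Eq.trans ?_ h
  rw [occurrences]
  congr 1
  ext S
  simp only [Finset.mem_filter, Finset.mem_univ, true_and, Finset.mem_powersetCard,
    Finset.subset_univ]
  refine ⟨fun h => h.1, fun h => (isOccurrence_iff_of_card h).2 fun q => ?_⟩
  exact absurd q.2 (by simp [Subsingleton.elim q.1.1 q.1.2])

theorem abs_occurrences_sub_le_choose {n k : ℕ} (H : SimpleGraph (Fin k))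
    (G : SimpleGraph (Fin n)) :
    |(occurrences H G : ℝ) - n.choose k * subgraphProb k| ≤ n.choose k := by
  have h1 : (occurrences H G : ℝ) ≤ n.choose k := by exact_mod_cast occurrences_le_choose H G
  have h2 : (0 : ℝ) ≤ occurrences H G := Nat.cast_nonneg _
  have h3 : (0 : ℝ) ≤ n.choose k := Nat.cast_nonneg _
  have h4 := mul_nonneg h3 (subgraphProb_pos k).le
  have h5 := mul_le_of_le_one_right h3 (subgraphProb_le_one k)
  rw [abs_le]
  constructor <;> linarith

/-- McDiarmid's inequality does not produce this term of α, which can be added because it is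
nonnegative. -/
theorem logb_choose_div_nonneg {n k : ℕ} (hk : 0 < k) (hkn : k ≤ n) :
    0 ≤ Real.logb 2 ((n.choose k : ℝ) / ((n : ℝ) / k)) := by
  have hn : (0 : ℝ) < n := by exact_mod_cast hk.trans_le hkn
  have hk' : (0 : ℝ) < k := by exact_mod_cast hk
  refine Real.logb_nonneg one_lt_two ?_
  rw [one_le_div (by positivity), div_le_iff₀ hk']
  obtain ⟨j, rfl⟩ := Nat.exists_eq_succ_of_ne_zero hk.ne'
  obtain ⟨m, rfl⟩ := Nat.exists_eq_succ_of_ne_zero (hk.trans_le hkn).ne'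
  have h := Nat.add_one_mul_choose_eq m j
  have h2 : 0 < m.choose j := Nat.choose_pos (by omega)
  have h3 : m + 1 ≤ (m + 1).choose (j + 1) * (j + 1) := by
    rw [← h]; exact Nat.le_mul_of_pos_right _ h2
  exact_mod_cast h3

theorem theorem1 (U V : Machine) (hU : U.IsUniversal) (hV : V.IsUniversalPrefix) :
    ∃ c : ℝ, ∀ (δ : ℕ → ℝ) (n k : ℕ) (G : SimpleGraph (Fin n)) (H : SimpleGraph (Fin k)),
      0 < k → k ∣ n → (k : ℝ) ≤ √(2 * Real.logb 2 n) →
      (n.choose 2 : ℝ) - δ n ≤ U.complexity (edgeString G) (natToString n) →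
      |(occurrences H G : ℝ) - n.choose k * subgraphProb k| ≤
        n.choose k * √(alpha V c (δ n) n H * ((k : ℝ) / n) * subgraphProb k) := by
  obtain ⟨c, hc⟩ := exists_complexity_le_of_deviation hU hV
  obtain ⟨N, hN⟩ := exists_forall_cube_mul_le
  -- The second summand dominates n 2^C(k,2) for all k ≤ n < N.
  refine ⟨c + N * 2 ^ (N * N), fun δ n k G H hk hkn hkl hG => ?_⟩
  have hn : 0 < n := by
    rcases Nat.eq_zero_or_pos n with rfl | hn
    -- Every `k` divides 0, but the convention log 0 = 0 turns the bound on `k` into k ≤ 0.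
    · simp only [CharP.cast_eq_zero, Real.logb_zero, mul_zero, Real.sqrt_zero] at hkl
      exact absurd hkl (by simpa using hk.ne')
    · exact hn
  have hle := Nat.le_of_dvd hn hkn
  have hn' : (0 : ℝ) < n := by exact_mod_cast hn
  have hk' : (1 : ℝ) ≤ k := by exact_mod_cast hk
  have hp := subgraphProb_pos k
  rcases Nat.lt_or_ge k 2 with hk1 | hk2
  · obtain rfl : k = 1 := by omega
    have : (occurrences H G : ℝ) - n.choose 1 * subgraphProb 1 = 0 := by
      rw [occurrences_eq_of_one]
      simp [subgraphProb]
    rw [this, abs_zero]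
    positivity
  have hc := hc n k G H hk2 hle
  have he := logb_exp_one_pos
  have hL := logb_choose_div_nonneg hk hle
  set d := (occurrences H G : ℝ) - n.choose k * subgraphProb k with hd
  set W := (n.choose 2 : ℝ) * ((n - 2).choose (k - 2) : ℝ) ^ 2 with hW
  have hW0 : 0 < W := by
    have h1 : (0 : ℝ) < n.choose 2 := by exact_mod_cast Nat.choose_pos (by omega)
    have h2 : (0 : ℝ) < (n - 2).choose (k - 2) := by exact_mod_cast Nat.choose_pos (by omega)
    positivity
  set X := (V.complexity (edgeString H) (natToString n) : ℝ) + δ n + c with hX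
  have hdX : 2 * d ^ 2 / W * Real.logb 2 (Real.exp 1) ≤ X := by linarith
  -- No sign of δ is assumed; `X` is nonnegative because it bounds a nonnegative quantity.
  have hX0 : 0 ≤ X := le_trans (by positivity) hdX
  have hα : (X + N * 2 ^ (N * N)) * 3 / Real.logb 2 (Real.exp 1) ≤
      alpha V (c + N * 2 ^ (N * N)) (δ n) n H := by
    rw [alpha]
    refine div_le_div_of_nonneg_right (mul_le_mul_of_nonneg_right ?_ (by norm_num)) he.le
    linarith
  rcases le_or_gt N n with hNn | hNn
  · have hα' : X * 3 / Real.logb 2 (Real.exp 1) ≤ alpha V (c + N * 2 ^ (N * N)) (δ n) n H := by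
      refine le_trans ?_ hα
      gcongr
      have : (0 : ℝ) ≤ N * 2 ^ (N * N) := by positivity
      linarith
    have hWle := choose_two_mul_sq_le hk2 hle (hN n k hNn hn hk hkl)
    rw [← hW] at hWle
    have hd2 : d ^ 2 ≤ (n.choose k : ℝ) ^ 2 *
        (alpha V (c + N * 2 ^ (N * N)) (δ n) n H * ((k : ℝ) / n) * subgraphProb k) := by
      -- The factor 3 in α is the 6 of `choose_two_mul_sq_le` divided by the 2 of McDiarmid's
      -- exponent.
      calc d ^ 2 = 2 * d ^ 2 / W * Real.logb 2 (Real.exp 1) *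
            (W / (2 * Real.logb 2 (Real.exp 1))) := by field_simp
        _ ≤ X * (6 * (n.choose k : ℝ) ^ 2 * ((k : ℝ) / n * subgraphProb k) /
            (2 * Real.logb 2 (Real.exp 1))) := by gcongr
        _ = (n.choose k : ℝ) ^ 2 * (X * 3 / Real.logb 2 (Real.exp 1) * ((k : ℝ) / n) *
            subgraphProb k) := by field_simp; ring
        _ ≤ _ := by gcongr
    have := Real.abs_le_sqrt hd2
    rwa [Real.sqrt_mul (by positivity), Real.sqrt_sq (by positivity)] at this
  -- For n < N it suffices that the radicand is at least 1; since α ≥ n 2^C(k,2), it is at least k.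
  · refine (abs_occurrences_sub_le_choose H G).trans (le_mul_of_one_le_right (by positivity) ?_)
    rw [Real.one_le_sqrt]
    have h1 : (n : ℝ) * 2 ^ k.choose 2 ≤ N * 2 ^ (N * N) := by
      have : n * 2 ^ k.choose 2 ≤ N * 2 ^ (N * N) :=
        Nat.mul_le_mul hNn.le (Nat.pow_le_pow_right two_pos ((choose_two_le_mul_self k).trans
          (Nat.mul_le_mul (hle.trans hNn.le) (hle.trans hNn.le))))
      exact_mod_cast this
    have h2 : (n : ℝ) * 2 ^ k.choose 2 ≤ alpha V (c + N * 2 ^ (N * N)) (δ n) n H := by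
      refine le_trans ?_ hα
      rw [le_div_iff₀ he]
      have h3 : (0 : ℝ) ≤ N * 2 ^ (N * N) := by positivity
      have h4 := mul_le_mul h1 logb_exp_one_le he.le h3
      linarith
    calc (1 : ℝ) ≤ k := hk'
      _ = n * 2 ^ k.choose 2 * ((k : ℝ) / n) * subgraphProb k := by
        rw [subgraphProb]; field_simp
      _ ≤ _ := by gcongr
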